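/- Let $p$ be a prime, let $K$ be a field of characteristic $p$, and let $\delta:K\to K$ be a derivation with field of constants $F=\{a\in K\mid\delta(a)=0\}$, such that $\delta$, viewed as an $F$-linear endomorphism of $K$, has minimum polynomial $t^p-t\in F[t]$. Let $x$ be an indeterminate and extend $\delta$ to the derivation of $K(x)$, again denoted $\delta$, with $\delta(x)=0$. Then the field of constants of the extended $\delta$ is $F(x)$, and its minimum polynomial over $F(x)$ is again $t^p-t$. Let $R=K(x)[t;\delta]$ be the differential polynomial ring, whose elements are the polynomials $\sum_i a_it^i$ with $a_i\in K(x)$, with termwise addition and multiplication determined by $ta=at+\delta(a)$ for $a\in K(x)$. For $h(x)\in K(x)$ put $f(t)=t^p-t-h(x)\in R$, and let $(K(x),\delta,h(x))=R/Rf$ be the set of all $g\in R$ of degree less than $p$ with the multiplication $g\circ g'=gg'\ \mathrm{mod}_r f$, where $\mathrm{mod}_r f$ denotes the remainder $r$ in the right division $gg'=qf+r$, $\deg r<p$. Then for every $h(x)\in K(x)\setminus F(x)$: 1. $f(t)=t^p-t-h(x)$ is irreducible in $R$; 2. $A=(K(x),\delta,h(x))$ is a unital division algebra over $F(x)$ of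 dimension $p^2$ that is not associative; here an algebra $A\neq0$ over a field is called a division algebra if left and right multiplication by every nonzero element of $A$ are bijective; 3. $A$ is a nonassociative cyclic extension of $K(x)$ of degree $p$: it is a division algebra that contains $K(x)$, it has dimension $p$ as a left $K(x)$-vector space, and its group of $F(x)$-algebra automorphisms contains a cyclic subgroup of order $p$ which leaves $K(x)$ elementwise fixed. -/

import Mathlib

open Polynomial

noncomputable section

namespace PetitExt

/-! ### Derivations: constants, minimum polynomial, extension to rational functions -/

section Derivations

variable {K : Type*} [Field K]

/-- Derivations `δ : K → K` of a field (additive maps with `δ (a b) = a δ b + b δ a`). -/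
abbrev Der (K : Type*) [Field K] := Derivation ℤ K K

/-- A derivation from an additive map satisfying the Leibniz rule. -/
def Der.ofLeibniz (φ : K → K) (hadd : ∀ a b, φ (a + b) = φ a + φ b)
    (hmul : ∀ a b, φ (a * b) = a * φ b + b * φ a) : Der K :=
  Derivation.mk' (AddMonoidHom.toIntLinearMap (AddMonoidHom.mk' φ hadd)) hmul

/-- The field of constants `Const(δ) = {a | δ a = 0}` of a derivation of a field. -/
def constField (δ : Der K) : Subfield K where
  carrier := {a | δ a = 0}
  mul_mem' {a b} ha hb := by
    simp only [Set.mem_ofPred_eq] at *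
    simp [ha, hb]
  one_mem' := by simp
  add_mem' {a b} ha hb := by
    simp only [Set.mem_ofPred_eq] at *
    simp [ha, hb]
  zero_mem' := by simp
  neg_mem' {a} ha := by
    simp only [Set.mem_ofPred_eq] at *
    simp [ha]
  inv_mem' a ha := by
    simp only [Set.mem_ofPred_eq] at *
    simp [Derivation.leibniz_inv, ha]

/-- A derivation as an endomorphism of the vector space `K` over its field of constants.
The minimum polynomial of `δ` is `minpoly (constField δ) (constEnd δ)`. -/
def constEnd (δ : Der K) : Module.End (constField δ) K where
  toFun := δ
  map_add' := map_add δ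
  map_smul' c a := by
    have hc : δ (c : K) = 0 := c.2
    change δ ((c : K) * a) = (c : K) * δ a
    simp [hc]

/-- The derivation of `K[x]` acting as `δ` on each coefficient (so `x ↦ 0`). -/
def coeffDer (δ : Der K) : Derivation ℤ K[X] K[X] :=
  PolynomialModule.equivPolynomialSelf.compDer δ.mapCoeffs

@[simp]
theorem coeff_coeffDer (δ : Der K) (f : K[X]) (n : ℕ) :
    (coeffDer δ f).coeff n = δ (f.coeff n) := rfl

theorem coeffDer_C (δ : Der K) (a : K) : coeffDer δ (C a) = C (δ a) := by
  ext n
  simp [coeff_C, apply_ite δ]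

theorem coeffDer_X (δ : Der K) : coeffDer δ X = 0 := by
  ext n
  simp [coeff_X, apply_ite δ]

/-- The quotient rule, on the reduced representation of a rational function. -/
def quotRule (δ : Der K) (r : RatFunc K) : RatFunc K :=
  (algebraMap K[X] (RatFunc K) (coeffDer δ r.num) * algebraMap K[X] (RatFunc K) r.denom
    - algebraMap K[X] (RatFunc K) r.num * algebraMap K[X] (RatFunc K) (coeffDer δ r.denom))
    / algebraMap K[X] (RatFunc K) r.denom ^ 2

theorem quotRule_div (δ : Der K) (f g : K[X]) (hg : g ≠ 0) :
    quotRule δ (algebraMap K[X] (RatFunc K) f / algebraMap K[X] (RatFunc K) g) =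
      (algebraMap K[X] (RatFunc K) (coeffDer δ f) * algebraMap K[X] (RatFunc K) g
        - algebraMap K[X] (RatFunc K) f * algebraMap K[X] (RatFunc K) (coeffDer δ g))
        / algebraMap K[X] (RatFunc K) g ^ 2 := by
  generalize hr : algebraMap K[X] (RatFunc K) f / algebraMap K[X] (RatFunc K) g = r
  have key : r.num * g = f * r.denom := (RatFunc.num_mul_eq_mul_denom_iff hg).2 hr.symm
  have hg' : algebraMap K[X] (RatFunc K) g ≠ 0 := RatFunc.algebraMap_ne_zero hg
  have hd' : algebraMap K[X] (RatFunc K) r.denom ≠ 0 :=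
    RatFunc.algebraMap_ne_zero (RatFunc.denom_ne_zero r)
  have e1 := congrArg (algebraMap K[X] (RatFunc K)) key
  have e2 := congrArg (fun q => algebraMap K[X] (RatFunc K) (coeffDer δ q)) key
  simp only [Derivation.leibniz, smul_eq_mul, map_mul, map_add] at e1 e2
  unfold quotRule
  rw [div_eq_div_iff (pow_ne_zero 2 hd') (pow_ne_zero 2 hg')]
  linear_combination (algebraMap K[X] (RatFunc K) r.denom * algebraMap K[X] (RatFunc K) g) * e2
    - (algebraMap K[X] (RatFunc K) g * algebraMap K[X] (RatFunc K) (coeffDer δ r.denom)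
      + algebraMap K[X] (RatFunc K) r.denom * algebraMap K[X] (RatFunc K) (coeffDer δ g)) * e1

/-- The extension of `δ` to `K(x)` with `δ x = 0`: coefficientwise on polynomials, and by the
quotient rule on fractions. -/
def ratDer (δ : Der K) : Der (RatFunc K) :=
  Der.ofLeibniz (quotRule δ)
    (by
      intro r s
      induction r using RatFunc.induction_on with | _ a b hb
      induction s using RatFunc.induction_on with | _ c d hd
      have hb' : algebraMap K[X] (RatFunc K) b ≠ 0 := RatFunc.algebraMap_ne_zero hb
      have hd' : algebraMap K[X] (RatFunc K) d ≠ 0 := RatFunc.algebraMap_ne_zero hd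
      rw [div_add_div _ _ hb' hd', ← map_mul, ← map_mul, ← map_mul, ← map_add,
        quotRule_div δ _ _ (mul_ne_zero hb hd), quotRule_div δ _ _ hb, quotRule_div δ _ _ hd]
      simp only [Derivation.leibniz, smul_eq_mul, map_mul, map_add]
      field_simp
      ring)
    (by
      intro r s
      induction r using RatFunc.induction_on with | _ a b hb
      induction s using RatFunc.induction_on with | _ c d hd
      have hb' : algebraMap K[X] (RatFunc K) b ≠ 0 := RatFunc.algebraMap_ne_zero hb
      have hd' : algebraMap K[X] (RatFunc K) d ≠ 0 := RatFunc.algebraMap_ne_zero hd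
      rw [div_mul_div_comm, ← map_mul, ← map_mul,
        quotRule_div δ _ _ (mul_ne_zero hb hd), quotRule_div δ _ _ hb, quotRule_div δ _ _ hd]
      simp only [Derivation.leibniz, smul_eq_mul, map_mul, map_add]
      field_simp
      ring)

theorem ratDer_algebraMap (δ : Der K) (f : K[X]) :
    ratDer δ (algebraMap K[X] (RatFunc K) f) = algebraMap K[X] (RatFunc K) (coeffDer δ f) := by
  have h := quotRule_div δ f 1 one_ne_zero
  simp only [map_one, div_one, Derivation.map_one_eq_zero, map_zero, mul_zero, sub_zero,
    mul_one, one_pow] at h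
  exact h

/-- `ratDer δ` extends `δ`. -/
theorem ratDer_C (δ : Der K) (a : K) :
    ratDer δ (RatFunc.C a) = RatFunc.C (δ a) := by
  rw [← RatFunc.algebraMap_C, ratDer_algebraMap, coeffDer_C, RatFunc.algebraMap_C]

/-- `ratDer δ` annihilates the indeterminate. -/
theorem ratDer_X (δ : Der K) : ratDer δ RatFunc.X = 0 := by
  rw [← RatFunc.algebraMap_X, ratDer_algebraMap, coeffDer_X, map_zero]

/-- For a subfield `F` of `K`, the field `F(x)` inside `K(x)`: the rational functions with
coefficients in `F`. -/
def ratSubfield (F : Subfield K) : Subfield (RatFunc K) :=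
  (RatFunc.mapRingHom (Polynomial.mapRingHom F.subtype)
    (nonZeroDivisors_le_comap_nonZeroDivisors_of_injective _
      (Polynomial.map_injective F.subtype F.subtype.injective))).fieldRange

end Derivations

/-! ### The differential polynomial ring -/

section DiffPoly

variable {K : Type*} [Field K]

/-- Left multiplication by `t` in `K[t;δ]`, on polynomials `∑ aᵢ tⁱ` with coefficients written on
the left: `t (∑ aᵢ tⁱ) = ∑ aᵢ tⁱ⁺¹ + ∑ δ(aᵢ) tⁱ`. -/
def tMul (δ : Der K) : AddMonoid.End K[X] :=
  AddMonoidHom.mulLeft X + (coeffDer δ : K[X] →ₗ[ℤ] K[X]).toAddMonoidHom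

/-- Left multiplication by a scalar. -/
def cMul (a : K) : AddMonoid.End K[X] := AddMonoidHom.mulLeft (C a)

/-- Left multiplication by `∑ aᵢ tⁱ` in `K[t;δ]`. -/
def lMul (δ : Der K) (f : K[X]) : AddMonoid.End K[X] :=
  f.sum fun i a => cMul a * tMul δ ^ i

theorem end_mul_apply (e e' : AddMonoid.End K[X]) (g : K[X]) : (e * e') g = e (e' g) := rfl

theorem end_add_apply (e e' : AddMonoid.End K[X]) (g : K[X]) : (e + e') g = e g + e' g := rfl

theorem tMul_apply (δ : Der K) (g : K[X]) : tMul δ g = X * g + coeffDer δ g := rfl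

theorem cMul_apply (a : K) (g : K[X]) : cMul a g = C a * g := rfl

theorem cMul_zero : cMul (0 : K) = 0 := by
  ext1 g
  simp [cMul_apply]

theorem cMul_add (a b : K) : cMul (a + b) = cMul a + cMul b := by
  ext1 g
  simp only [cMul_apply, end_add_apply, C_add, add_mul]

theorem cMul_mul (a b : K) : cMul (a * b) = cMul a * cMul b := by
  ext1 g
  simp [cMul_apply, mul_assoc]

/-- The commutation rule `t a = a t + δ(a)`. -/
theorem tMul_mul_cMul (δ : Der K) (a : K) :
    tMul δ * cMul a = cMul a * tMul δ + cMul (δ a) := by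
  ext1 g
  simp only [end_mul_apply, end_add_apply, tMul_apply, cMul_apply,
    Derivation.leibniz, coeffDer_C, smul_eq_mul]
  ring

theorem lMul_monomial (δ : Der K) (i : ℕ) (a : K) :
    lMul δ (monomial i a) = cMul a * tMul δ ^ i := by
  unfold lMul
  rw [Polynomial.sum_monomial_index]
  rw [cMul_zero, zero_mul]

theorem lMul_add (δ : Der K) (f g : K[X]) :
    lMul δ (f + g) = lMul δ f + lMul δ g := by
  unfold lMul
  rw [Polynomial.sum_add_index]
  · intro i
    rw [cMul_zero, zero_mul]
  · intro i a b
    rw [cMul_add, add_mul]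

theorem lMul_cMul (δ : Der K) (a : K) (g : K[X]) :
    lMul δ (cMul a g) = cMul a * lMul δ g := by
  induction g using Polynomial.induction_on' with
  | add p q hp hq => rw [map_add, lMul_add, hp, hq, lMul_add, mul_add]
  | monomial n b =>
    rw [cMul_apply, C_mul_monomial, lMul_monomial, lMul_monomial, cMul_mul, mul_assoc]

theorem coeffDer_monomial (δ : Der K) (n : ℕ) (a : K) :
    coeffDer δ (monomial n a) = monomial n (δ a) := by
  ext m
  simp [coeff_monomial, apply_ite δ]

theorem lMul_tMul (δ : Der K) (g : K[X]) :
    lMul δ (tMul δ g) = tMul δ * lMul δ g := by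
  induction g using Polynomial.induction_on' with
  | add p q hp hq => rw [map_add, lMul_add, hp, hq, lMul_add, mul_add]
  | monomial n b =>
    rw [tMul_apply, X_mul_monomial, coeffDer_monomial, lMul_add, lMul_monomial, lMul_monomial,
      lMul_monomial, ← mul_assoc, tMul_mul_cMul, add_mul, mul_assoc, ← pow_succ']

theorem lMul_tMul_pow (δ : Der K) (i : ℕ) (g : K[X]) :
    lMul δ ((tMul δ ^ i) g) = tMul δ ^ i * lMul δ g := by
  induction i with
  | zero => simp
  | succ n ih => rw [pow_succ', end_mul_apply, lMul_tMul, ih, mul_assoc]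

theorem lMul_lMul (δ : Der K) (f g : K[X]) :
    lMul δ (lMul δ f g) = lMul δ f * lMul δ g := by
  induction f using Polynomial.induction_on' with
  | add p q hp hq => rw [lMul_add, end_add_apply, lMul_add, hp, hq, add_mul]
  | monomial n b =>
    rw [lMul_monomial, end_mul_apply, lMul_cMul, lMul_tMul_pow, mul_assoc]

theorem tMul_pow_one (δ : Der K) (i : ℕ) : (tMul δ ^ i) (1 : K[X]) = X ^ i := by
  induction i with
  | zero => simp
  | succ n ih =>
    rw [pow_succ', end_mul_apply, ih, tMul_apply, Derivation.leibniz_pow, coeffDer_X]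
    simp [pow_succ']

theorem lMul_one (δ : Der K) (f : K[X]) : lMul δ f 1 = f := by
  induction f using Polynomial.induction_on' with
  | add p q hp hq => rw [lMul_add, end_add_apply, hp, hq]
  | monomial n b =>
    rw [lMul_monomial, end_mul_apply, tMul_pow_one, cMul_apply, C_mul_X_pow_eq_monomial]

theorem one_lMul (δ : Der K) : lMul δ 1 = 1 := by
  rw [← C_1, ← monomial_zero_left, lMul_monomial]
  ext1 g
  simp [cMul_apply]

/-- The differential polynomial ring `K[t;δ]`: its elements are the polynomials `∑ aᵢ tⁱ` (stored as
ordinary polynomials with the coefficients on the left), multiplied by the rule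
`t a = a t + δ(a)`. -/
def DiffPoly (_δ : Der K) : Type _ := K[X]

namespace DiffPoly

variable {δ : Der K}

instance : AddCommGroup (DiffPoly δ) := inferInstanceAs (AddCommGroup K[X])

instance : Module K (DiffPoly δ) := inferInstanceAs (Module K K[X])

/-- The underlying coefficient sequence, as an ordinary polynomial (additive data only). -/
def toPoly : DiffPoly δ ≃ₗ[K] K[X] := LinearEquiv.refl K K[X]

instance : Mul (DiffPoly δ) := ⟨fun f g => toPoly.symm (lMul δ (toPoly f) (toPoly g))⟩

instance : One (DiffPoly δ) := ⟨toPoly.symm 1⟩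

theorem toPoly_mul (f g : DiffPoly δ) : toPoly (f * g) = lMul δ (toPoly f) (toPoly g) := rfl

theorem toPoly_one : toPoly (1 : DiffPoly δ) = 1 := rfl

instance : Ring (DiffPoly δ) :=
  { (inferInstance : AddCommGroup (DiffPoly δ)),
    (inferInstance : Mul (DiffPoly δ)), (inferInstance : One (DiffPoly δ)) with
    left_distrib := fun f g h => map_add (lMul δ (toPoly f)) (toPoly g) (toPoly h)
    right_distrib := fun f g h =>
      congrArg (fun e => e (toPoly h)) (lMul_add δ (toPoly f) (toPoly g))
    zero_mul := fun f => by
      apply toPoly.injective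
      rw [toPoly_mul, map_zero]
      simp [lMul]
    mul_zero := fun f => map_zero (lMul δ (toPoly f))
    mul_assoc := fun f g h =>
      congrArg (fun e => e (toPoly h)) (lMul_lMul δ (toPoly f) (toPoly g))
    one_mul := fun f => congrArg (fun e => e (toPoly f)) (one_lMul δ)
    mul_one := fun f => lMul_one δ (toPoly f) }

/-- The scalars of `K[t;δ]`. -/
def scal (δ : Der K) (a : K) : DiffPoly δ := toPoly.symm (C a)

/-- The variable of `K[t;δ]`. -/
def t (δ : Der K) : DiffPoly δ := toPoly.symm X

/-- The degree of a differential polynomial (`⊥` for `0`). -/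
def degree (f : DiffPoly δ) : WithBot ℕ := (toPoly f).degree

theorem scal_mul (a : K) (f : DiffPoly δ) : scal δ a * f = a • f := by
  apply toPoly.injective
  rw [toPoly_mul, map_smul]
  change lMul δ (C a) _ = _
  rw [← monomial_zero_left, lMul_monomial, smul_eq_C_mul]
  simp [cMul_apply]

/-- The defining relation `t a = a t + δ(a)`. -/
theorem t_mul_scal (a : K) : t δ * scal δ a = scal δ a * t δ + scal δ (δ a) := by
  rw [scal_mul]
  apply toPoly.injective
  rw [toPoly_mul, map_add, map_smul]
  change lMul δ X (C a) = a • X + C (δ a)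
  rw [← monomial_one_one_eq_X, lMul_monomial]
  simp [end_mul_apply, cMul_apply, tMul_apply, coeffDer_C, smul_eq_C_mul,
    monomial_one_one_eq_X, X_mul_C]

instance : IsScalarTower K (DiffPoly δ) (DiffPoly δ) where
  smul_assoc a f g := by
    rw [smul_eq_mul, smul_eq_mul, ← scal_mul, ← scal_mul, mul_assoc]

theorem toPoly_eq_zero_iff (f : DiffPoly δ) : toPoly f = 0 ↔ f = 0 :=
  LinearEquiv.map_eq_zero_iff toPoly

theorem degree_coeffDer_le (g : K[X]) : (coeffDer δ g).degree ≤ g.degree := by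
  rw [degree_le_iff_coeff_zero]
  intro m hm
  rw [coeff_coeffDer, coeff_eq_zero_of_degree_lt hm, map_zero]

theorem tMul_top (g : K[X]) (hg : g ≠ 0) :
    (tMul δ g).degree = g.degree + 1 ∧ (tMul δ g).leadingCoeff = g.leadingCoeff := by
  have h1 : (X * g).degree = g.degree + 1 := by rw [degree_mul, degree_X, add_comm]
  have h2 : (coeffDer δ g).degree < (X * g).degree := by
    refine lt_of_le_of_lt (degree_coeffDer_le g) ?_
    rw [h1, degree_eq_natDegree hg]
    exact_mod_cast Nat.lt_succ_self _
  rw [tMul_apply]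
  refine ⟨by rw [degree_add_eq_left_of_degree_lt h2, h1], ?_⟩
  rw [leadingCoeff_add_of_degree_lt' h2, leadingCoeff_mul, leadingCoeff_X, one_mul]

theorem tMul_pow_top (g : K[X]) (hg : g ≠ 0) (n : ℕ) :
    ((tMul δ ^ n) g).degree = g.degree + n ∧ ((tMul δ ^ n) g).leadingCoeff = g.leadingCoeff := by
  induction n with
  | zero => simp
  | succ n ih =>
    have h0 : (tMul δ ^ n) g ≠ 0 := by
      rw [← leadingCoeff_ne_zero, ih.2]
      exact leadingCoeff_ne_zero.2 hg
    rw [pow_succ', end_mul_apply]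
    refine ⟨?_, by rw [(tMul_top _ h0).2, ih.2]⟩
    rw [(tMul_top _ h0).1, ih.1, add_assoc]
    push_cast
    rfl

theorem degree_lMul (f : K[X]) (hf : f ≠ 0) (q : K[X]) :
    (lMul δ q f).degree = q.degree + f.degree := by
  induction hn : q.natDegree using Nat.strong_induction_on generalizing q with
  | _ n ih =>
  by_cases hq : q = 0
  · subst hq
    simp [lMul]
  have hlc : q.leadingCoeff ≠ 0 := leadingCoeff_ne_zero.2 hq
  have htop : (C q.leadingCoeff * (tMul δ ^ q.natDegree) f).degree = q.degree + f.degree := by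
    rw [degree_C_mul hlc, (tMul_pow_top f hf _).1, degree_eq_natDegree hq, add_comm]
  have hdec : lMul δ q f =
      lMul δ q.eraseLead f + C q.leadingCoeff * (tMul δ ^ q.natDegree) f := by
    conv_lhs => rw [← eraseLead_add_monomial_natDegree_leadingCoeff q]
    rw [lMul_add, lMul_monomial]
    rfl
  rw [hdec, degree_add_eq_right_of_degree_lt, htop]
  rw [htop]
  by_cases he : q.eraseLead = 0
  · have h0 : lMul δ (0 : K[X]) f = 0 := by simp [lMul]
    rw [he, h0, degree_zero, degree_eq_natDegree hq, degree_eq_natDegree hf]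
    exact WithBot.bot_lt_coe (q.natDegree + f.natDegree)
  · have hlt : q.eraseLead.degree < q.degree := degree_eraseLead_lt hq
    have hnat : q.eraseLead.natDegree < n := hn ▸ natDegree_lt_natDegree he hlt
    rw [ih _ hnat _ rfl, degree_eq_natDegree hq, degree_eq_natDegree hf, degree_eq_natDegree he]
    rw [degree_eq_natDegree hq, degree_eq_natDegree he] at hlt
    exact_mod_cast Nat.add_lt_add_right (by exact_mod_cast hlt) _

/-- Degrees add in `K[t;δ]`. -/
theorem degree_mul (f g : DiffPoly δ) : (f * g).degree = f.degree + g.degree := by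
  by_cases hg : g = 0
  · subst hg
    simp [degree]
  · exact degree_lMul _ (mt (toPoly_eq_zero_iff g).1 hg) _

/-- Existence in the right division algorithm `g = q f + r`. -/
theorem exists_rightDiv (f : DiffPoly δ) (hf : f ≠ 0) (g : DiffPoly δ) :
    ∃ r : DiffPoly δ, r.degree < f.degree ∧ ∃ q : DiffPoly δ, g = q * f + r := by
  have hf' : toPoly f ≠ 0 := mt (toPoly_eq_zero_iff f).1 hf
  induction hn : g.degree using WellFoundedLT.induction generalizing g with
  | _ n ih =>
  by_cases hlt : g.degree < f.degree
  · exact ⟨g, hlt, 0, by rw [zero_mul, zero_add]⟩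
  have hle : f.degree ≤ g.degree := not_lt.1 hlt
  have hg' : toPoly g ≠ 0 := by
    intro h0
    rw [degree, degree, h0, degree_zero, le_bot_iff, degree_eq_bot] at hle
    exact hf' hle
  have hnat : (toPoly f).natDegree ≤ (toPoly g).natDegree := natDegree_le_natDegree hle
  have hlf : (toPoly f).leadingCoeff ≠ 0 := leadingCoeff_ne_zero.2 hf'
  have hlg : (toPoly g).leadingCoeff ≠ 0 := leadingCoeff_ne_zero.2 hg'
  set c : K := (toPoly g).leadingCoeff / (toPoly f).leadingCoeff with hc
  have hc0 : c ≠ 0 := div_ne_zero hlg hlf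
  set m : ℕ := (toPoly g).natDegree - (toPoly f).natDegree with hm
  set u : DiffPoly δ := toPoly.symm (monomial m c) with hu
  have huf : toPoly (u * f) = C c * (tMul δ ^ m) (toPoly f) := by
    rw [toPoly_mul, hu, LinearEquiv.apply_symm_apply, lMul_monomial]
    rfl
  have hdeg : (toPoly g).degree = (toPoly (u * f)).degree := by
    rw [huf, degree_C_mul hc0, (tMul_pow_top _ hf' _).1, degree_eq_natDegree hf',
      degree_eq_natDegree hg', hm]
    exact_mod_cast (Nat.add_sub_cancel' hnat).symm
  have hlead : (toPoly g).leadingCoeff = (toPoly (u * f)).leadingCoeff := by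
    rw [huf, leadingCoeff_mul, leadingCoeff_C, (tMul_pow_top _ hf' _).2, hc,
      div_mul_cancel₀ _ hlf]
  have hred : (g - u * f).degree < n := by
    rw [← hn, degree, map_sub]
    exact degree_sub_lt_left hdeg hg' hlead
  obtain ⟨r, hr, q, hq⟩ := ih _ hred (g - u * f) rfl
  refine ⟨r, hr, u + q, ?_⟩
  rw [add_mul, add_assoc, ← hq]
  abel

/-- Uniqueness in the right division algorithm. -/
theorem rightDiv_unique (f : DiffPoly δ) {q q' r r' : DiffPoly δ} (hr : r.degree < f.degree)
    (hr' : r'.degree < f.degree) (h : q * f + r = q' * f + r') : r = r' := by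
  have h1 : (q - q') * f = r' - r := by
    rw [sub_mul, sub_eq_sub_iff_add_eq_add, h, add_comm]
  have h2 : (r' - r).degree < f.degree := by
    rw [degree, map_sub]
    exact lt_of_le_of_lt (degree_sub_le _ _) (max_lt hr' hr)
  have h3 : q - q' = 0 := by
    by_contra hne
    have hne' : toPoly (q - q') ≠ 0 := mt (toPoly_eq_zero_iff _).1 hne
    rw [← h1, degree_mul] at h2
    have h4 : (0 : WithBot ℕ) ≤ (q - q').degree := zero_le_degree_iff.2 hne'
    exact absurd h2 (not_lt.2 (le_add_of_nonneg_left h4))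
  rw [h3, zero_mul] at h1
  exact (sub_eq_zero.1 h1.symm).symm

open Classical in
/-- The remainder `g mod_r f` of right division by `f`: the unique `r` with `deg r < deg f` and
`g = q f + r` for some `q` (and `0` if `f = 0`). -/
def modR (f g : DiffPoly δ) : DiffPoly δ :=
  if h : ∃ r : DiffPoly δ, r.degree < f.degree ∧ ∃ q : DiffPoly δ, g = q * f + r
  then h.choose else 0

theorem modR_zero_left (g : DiffPoly δ) : modR 0 g = 0 := by
  unfold modR
  rw [dif_neg]
  rintro ⟨r, hr, -⟩
  rw [degree, degree, map_zero, degree_zero] at hr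
  exact not_lt_bot hr

theorem modR_spec (f : DiffPoly δ) (hf : f ≠ 0) (g : DiffPoly δ) :
    (modR f g).degree < f.degree ∧ ∃ q : DiffPoly δ, g = q * f + modR f g := by
  have h := exists_rightDiv f hf g
  unfold modR
  rw [dif_pos h]
  exact h.choose_spec

theorem modR_eq (f : DiffPoly δ) {g q r : DiffPoly δ} (hr : r.degree < f.degree)
    (h : g = q * f + r) : modR f g = r := by
  have hf : f ≠ 0 := by
    rintro rfl
    rw [degree, degree, map_zero, degree_zero] at hr
    exact not_lt_bot hr
  obtain ⟨h1, q', h2⟩ := modR_spec f hf g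
  exact rightDiv_unique f h1 hr (h2.symm.trans h)

theorem modR_add (f g h : DiffPoly δ) : modR f (g + h) = modR f g + modR f h := by
  by_cases hf : f = 0
  · subst hf
    simp only [modR_zero_left, add_zero]
  obtain ⟨h1, q, h2⟩ := modR_spec f hf g
  obtain ⟨h3, q', h4⟩ := modR_spec f hf h
  refine modR_eq f (q := q + q') ?_ ?_
  · rw [degree, map_add]
    exact lt_of_le_of_lt (degree_add_le _ _) (max_lt h1 h3)
  · conv_lhs => rw [h2, h4]
    rw [add_mul]
    abel

theorem modR_smul (f : DiffPoly δ) (c : K) (g : DiffPoly δ) :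
    modR f (c • g) = c • modR f g := by
  by_cases hf : f = 0
  · subst hf
    simp only [modR_zero_left, smul_zero]
  obtain ⟨h1, q, h2⟩ := modR_spec f hf g
  refine modR_eq f (q := c • q) ?_ ?_
  · rw [degree, map_smul]
    exact lt_of_le_of_lt (degree_smul_le _ _) h1
  · conv_lhs => rw [h2]
    rw [smul_add, smul_mul_assoc]

theorem modR_of_degree_lt (f : DiffPoly δ) {g : DiffPoly δ} (hg : g.degree < f.degree) :
    modR f g = g :=
  modR_eq f (q := 0) hg (by rw [zero_mul, zero_add])

/-- The space `R_m = {g | deg g < m}`, where `m = deg f`. -/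
def remainders (f : DiffPoly δ) : Submodule K (DiffPoly δ) :=
  (degreeLT K (toPoly f).natDegree).comap (toPoly : DiffPoly δ ≃ₗ[K] K[X]).toLinearMap

theorem mem_remainders (f : DiffPoly δ) (hf : f ≠ 0) (g : DiffPoly δ) :
    g ∈ remainders f ↔ g.degree < f.degree := by
  rw [remainders, Submodule.mem_comap, mem_degreeLT, degree, degree,
    degree_eq_natDegree (mt (toPoly_eq_zero_iff f).1 hf)]
  rfl

theorem modR_mem (f g : DiffPoly δ) : modR f g ∈ remainders f := by
  by_cases hf : f = 0
  · subst hf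
    rw [modR_zero_left]
    exact Submodule.zero_mem _
  · exact (mem_remainders f hf _).2 (modR_spec f hf g).1

theorem modR_of_mem (f : DiffPoly δ) {g : DiffPoly δ} (hg : g ∈ remainders f) :
    modR f g = g := by
  by_cases hf : f = 0
  · subst hf
    rw [modR_zero_left, eq_comm, ← toPoly_eq_zero_iff]
    rw [remainders, Submodule.mem_comap, mem_degreeLT, map_zero, natDegree_zero,
      Nat.cast_zero, ← not_le, zero_le_degree_iff, not_not] at hg
    exact hg
  · exact modR_of_degree_lt f ((mem_remainders f hf g).1 hg)

theorem modR_one_mul (f : DiffPoly δ) (g : DiffPoly δ) (hg : g ∈ remainders f) :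
    modR f (modR f 1 * g) = g := by
  by_cases h1 : (1 : DiffPoly δ).degree < f.degree
  · rw [modR_of_degree_lt f h1, one_mul, modR_of_mem f hg]
  · have h0 : ∀ x ∈ remainders f, x = 0 := by
      intro x hx
      rw [remainders, Submodule.mem_comap, mem_degreeLT] at hx
      have hn : (toPoly f).natDegree = 0 := by
        by_contra hne
        apply h1
        rw [degree, degree, toPoly_one, degree_one]
        exact natDegree_pos_iff_degree_pos.1 (Nat.pos_of_ne_zero hne)
      rw [hn, Nat.cast_zero, ← not_le, zero_le_degree_iff, not_not] at hx
      exact (toPoly_eq_zero_iff x).1 hx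
    rw [h0 _ hg, h0 _ (modR_mem f _)]

theorem modR_mul_one (f : DiffPoly δ) (g : DiffPoly δ) (hg : g ∈ remainders f) :
    modR f (g * modR f 1) = g := by
  by_cases h1 : (1 : DiffPoly δ).degree < f.degree
  · rw [modR_of_degree_lt f h1, mul_one, modR_of_mem f hg]
  · have h2 := modR_one_mul f _ (modR_mem f (g * modR f 1))
    have h3 := modR_one_mul f g hg
    have h0 : modR f (1 : DiffPoly δ) = 0 := by
      have hm := modR_mem f (1 : DiffPoly δ)
      rw [remainders, Submodule.mem_comap, mem_degreeLT] at hm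
      have hn : (toPoly f).natDegree = 0 := by
        by_contra hne
        apply h1
        rw [degree, degree, toPoly_one, degree_one]
        exact natDegree_pos_iff_degree_pos.1 (Nat.pos_of_ne_zero hne)
      rw [hn, Nat.cast_zero, ← not_le, zero_le_degree_iff, not_not] at hm
      exact (toPoly_eq_zero_iff _).1 hm
    rw [← h2, h0, zero_mul]
    rw [h0, zero_mul] at h3
    exact h3

end DiffPoly

end DiffPoly

/-! ### Petit algebras -/

section Petit

variable {K : Type*} [Field K] {δ : Der K}

open DiffPoly

/-- The Petit algebra `S_f = K[t;δ]/K[t;δ]f`: the space `R_m` of differential polynomials of degree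
less than `m = deg f`, with multiplication `g ∘ h = g h mod_r f`. -/
def PetitAlgebra (f : DiffPoly δ) : Type _ := remainders f

namespace PetitAlgebra

variable {f : DiffPoly δ}

instance : AddCommGroup (PetitAlgebra f) := inferInstanceAs (AddCommGroup (remainders f))

/-- The left `K`-vector space structure. -/
instance : Module K (PetitAlgebra f) := inferInstanceAs (Module K (remainders f))

instance : Mul (PetitAlgebra f) := ⟨fun g h => ⟨modR f (g.1 * h.1), modR_mem f _⟩⟩

/-- The unit is the polynomial `1` as soon as `deg f ≥ 1`. -/
instance : One (PetitAlgebra f) := ⟨⟨modR f 1, modR_mem f _⟩⟩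

instance : NonAssocRing (PetitAlgebra f) :=
  { (inferInstance : AddCommGroup (PetitAlgebra f)),
    (inferInstance : Mul (PetitAlgebra f)), (inferInstance : One (PetitAlgebra f)) with
    left_distrib := fun g h k => Subtype.ext <| by
      change modR f (g.1 * (h.1 + k.1)) = modR f (g.1 * h.1) + modR f (g.1 * k.1)
      rw [mul_add, modR_add]
    right_distrib := fun g h k => Subtype.ext <| by
      change modR f ((g.1 + h.1) * k.1) = modR f (g.1 * k.1) + modR f (h.1 * k.1)
      rw [add_mul, modR_add]
    zero_mul := fun g => Subtype.ext <| by
      change modR f (0 * g.1) = 0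
      rw [zero_mul, modR_of_mem f (Submodule.zero_mem _)]
    mul_zero := fun g => Subtype.ext <| by
      change modR f (g.1 * 0) = 0
      rw [mul_zero, modR_of_mem f (Submodule.zero_mem _)]
    one_mul := fun g => Subtype.ext (modR_one_mul f g.1 g.2)
    mul_one := fun g => Subtype.ext (modR_mul_one f g.1 g.2) }

/-- `(a g) ∘ h = a (g ∘ h)` for scalars `a ∈ K`. -/
instance : IsScalarTower K (PetitAlgebra f) (PetitAlgebra f) where
  smul_assoc a g h := Subtype.ext <| by
    change modR f ((a • g.1) * h.1) = a • modR f (g.1 * h.1)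
    rw [smul_mul_assoc, modR_smul]

end PetitAlgebra

/-- The differential polynomial `t^p - t - d` in `K[t;δ]`. -/
def cyclicPoly (p : ℕ) (δ : Der K) (d : K) : DiffPoly δ := t δ ^ p - t δ - scal δ d

/-- The algebra `(K, δ, d) = K[t;δ]/K[t;δ](t^p - t - d)`, for `δ` with minimum polynomial
`t^p - t`. -/
abbrev CyclicExt (p : ℕ) (δ : Der K) (d : K) : Type _ := PetitAlgebra (cyclicPoly p δ d)

end Petit

/-! ### Nonassociative division algebras and cyclic extensions -/

section Division

/-- `A` is a (not necessarily associative) unital division algebra over the field `F`: the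
multiplication is `F`-bilinear, `A ≠ 0`, and left and right multiplications by nonzero elements are
bijective. -/
structure IsDivisionAlgebra (F A : Type*) [Field F] [NonAssocRing A] [Module F A] : Prop where
  smul_mul : ∀ (c : F) (a b : A), (c • a) * b = c • (a * b)
  mul_smul : ∀ (c : F) (a b : A), a * (c • b) = c • (a * b)
  nontrivial : Nontrivial A
  left_bijective : ∀ a : A, a ≠ 0 → Function.Bijective fun b : A => a * b
  right_bijective : ∀ a : A, a ≠ 0 → Function.Bijective fun b : A => b * a

/-- The group `Aut_F(A)` of `F`-linear ring automorphisms of `A`. -/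
def algAut (F A : Type*) [Field F] [NonAssocRing A] [Module F A] : Subgroup (RingAut A) where
  carrier := {σ | ∀ (c : F) (a : A), σ (c • a) = c • σ a}
  mul_mem' {σ τ} hσ hτ c a := by
    change σ (τ (c • a)) = c • σ (τ a)
    rw [hτ c a, hσ c (τ a)]
  one_mem' _ _ := rfl
  inv_mem' {σ} hσ c a := by
    change σ.symm (c • a) = c • σ.symm a
    rw [RingEquiv.symm_apply_eq, hσ c, RingEquiv.apply_symm_apply]

/-- `A` is a nonassociative cyclic extension of degree `p` of the field `K`, as an algebra over
`F`: a division algebra over `F` which contains `K` (through the unital ring homomorphism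
`a ↦ a • 1`, whose left multiplications are the `K`-vector space structure of `A`), which has
dimension `p` over `K`, and whose automorphism group has a cyclic subgroup of order `p` that leaves
`K` elementwise fixed. -/
structure IsNonassocCyclicExtension (p : ℕ) (F K A : Type*) [Field F] [Field K] [NonAssocRing A]
    [Module F A] [Module K A] : Prop where
  division : IsDivisionAlgebra F A
  embed_injective : Function.Injective fun a : K => a • (1 : A)
  embed_mul : ∀ a b : K, (a * b) • (1 : A) = (a • (1 : A)) * (b • (1 : A))
  smul_eq_embed_mul : ∀ (a : K) (y : A), a • y = (a • (1 : A)) * y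
  finrank_eq : Module.finrank K A = p
  exists_cyclic : ∃ H : Subgroup (RingAut A), H ≤ algAut F A ∧ IsCyclic H ∧ Nat.card H = p ∧
    ∀ σ ∈ H, ∀ a : K, σ (a • (1 : A)) = a • (1 : A)

end Division

end PetitExt

end

namespace PetitExt

/-! ### Derivations with `δ^p = δ` and an eigenvector of eigenvalue 1 -/

section EigenvectorsOfDerivations

variable {p : ℕ} [Fact p.Prime] {L : Type*} [Field L]

/-! The hypothesis on `δ` is used only through two consequences: `δ^p = δ`, and some `u ≠ 0` has `δ
u = u`. Conversely, these two give back the minimum polynomial, since `u^i` has eigenvalue `i` for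
every `i` in the prime field, and they give degree `p` over the constants, since each eigenspace is
the line spanned by `u^i`. Both pass to `K(x)`: every fraction can be written with denominator a
`p`-th power, which is constant, so the extended derivation acts coefficientwise on the numerator.

In `R`, left multiplication by `t` is the sum of the commuting operators "multiply by `X`" and `δ`.
In characteristic `p` and with `δ^p = δ` this makes `z = t^p - t` central. If `f = z - d` factors as
`a b`, then `b d = (z - b a) b`; the two top coefficients give `deg b · δ(d) = 0`, so `p` divides
`deg b` and the factorization is trivial.

Irreducibility excludes zero divisors in `R/Rf` by a dimension count, and finite dimension then
makes one-sided multiplications bijective. Associativity fails because `f t = t f + δ(d)` is not in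
`R f`. The substitution `t ↦ t + 1` fixes `f` and the scalars and generates the cyclic group of
order `p`. -/

theorem X_pow_sub_X_dvd_of_eval_zmod_eq_zero {C : Type*} [Field C] [CharP C p] {P : C[X]}
    (hP : ∀ i : ZMod p, P.eval (ZMod.castHom (dvd_refl p) C i) = 0) :
    (X ^ p - X : C[X]) ∣ P := by
  have hp : 1 < p := (Fact.out : p.Prime).one_lt
  have hm : (X ^ p - X : C[X]).Monic := monic_X_pow_sub (by
    rw [degree_X]; exact_mod_cast hp)
  have hpow : ∀ i : ZMod p, ZMod.castHom (dvd_refl p) C i ^ p = ZMod.castHom (dvd_refl p) C i := by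
    intro i
    rw [← map_pow, ZMod.pow_card]
  rw [← modByMonic_eq_zero_iff_dvd hm]
  -- The remainder has degree less than `p` and vanishes at the `p` elements of the prime field.
  refine eq_zero_of_natDegree_lt_card_of_eval_eq_zero _
    (f := ZMod.castHom (dvd_refl p) C) (RingHom.injective _) ?_ ?_
  · intro i
    have h := congrArg (eval (ZMod.castHom (dvd_refl p) C i)) (modByMonic_add_div P (X ^ p - X))
    simpa only [eval_add, eval_mul, eval_sub, eval_pow, eval_X, hpow, sub_self, zero_mul, add_zero,
      hP] using h
  · rw [ZMod.card]
    have h := natDegree_modByMonic_lt P hm (by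
      intro h1
      have h2 := FiniteField.X_pow_card_sub_X_natDegree_eq C hp
      rw [h1, natDegree_one] at h2
      omega)
    rwa [FiniteField.X_pow_card_sub_X_natDegree_eq C hp] at h

omit [Fact p.Prime] in
instance constField_charP [CharP L p] (δ : Der L) : CharP (constField δ) p :=
  (RingHom.charP_iff (algebraMap (constField δ) L) (algebraMap (constField δ) L).injective p).2
    inferInstance

theorem constEnd_pow_apply (δ : Der L) (n : ℕ) (a : L) : (constEnd δ ^ n) a = δ^[n] a := by
  rw [Module.End.pow_apply]
  rfl

omit [Fact p.Prime] in
theorem aeval_constEnd_X_pow_sub_X_eq_zero_iff (δ : Der L) :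
    aeval (constEnd δ) (X ^ p - X : (constField δ)[X]) = 0 ↔ ∀ a, δ^[p] a = δ a := by
  rw [map_sub, map_pow, aeval_X, sub_eq_zero, LinearMap.ext_iff]
  simp only [constEnd_pow_apply]
  rfl

theorem der_pow_of_eigenvector (δ : Der L) {u : L} (hu : δ u = u) (n : ℕ) :
    δ (u ^ n) = n * u ^ n := by
  rw [Derivation.leibniz_pow, hu]
  cases n with
  | zero => simp
  | succ n => simp [pow_succ]

theorem der_div_of_const (δ : Der L) {a c : L} (hc : δ c = 0) : δ (a / c) = δ a / c := by
  rw [div_eq_mul_inv, Derivation.leibniz, Derivation.leibniz_inv, hc]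
  simp [div_eq_inv_mul]

theorem hasEigenvector_pow [CharP L p] (δ : Der L) {u : L} (hu0 : u ≠ 0) (hu : δ u = u)
    (i : ZMod p) :
    (constEnd δ).HasEigenvector (ZMod.castHom (dvd_refl p) (constField δ) i) (u ^ i.val) := by
  refine ⟨Module.End.mem_eigenspace_iff.2 ?_, pow_ne_zero _ hu0⟩
  change δ (u ^ i.val) = ((ZMod.castHom (dvd_refl p) (constField δ) i : constField δ) : L) *
    u ^ i.val
  rw [der_pow_of_eigenvector δ hu]
  congr 1
  conv_rhs => rw [← ZMod.natCast_zmod_val i, map_natCast]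
  rfl

/-- Eigenvalues are roots of the minimum polynomial, and the powers of `u` realize every element of
the prime field as an eigenvalue. -/
theorem minpoly_constEnd_eq [CharP L p] (δ : Der L) (hδ : ∀ a, δ^[p] a = δ a) {u : L}
    (hu0 : u ≠ 0) (hu : δ u = u) :
    minpoly (constField δ) (constEnd δ) = X ^ p - X := by
  have hp : 1 < p := (Fact.out : p.Prime).one_lt
  have hm : (X ^ p - X : (constField δ)[X]).Monic := monic_X_pow_sub (by
    rw [degree_X]; exact_mod_cast hp)
  have h0 := (aeval_constEnd_X_pow_sub_X_eq_zero_iff δ).2 hδ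
  refine (eq_of_monic_of_associated (minpoly.monic ⟨_, hm, h0⟩) hm
    (associated_of_dvd_dvd (minpoly.dvd _ _ h0) ?_))
  refine X_pow_sub_X_dvd_of_eval_zmod_eq_zero fun i => ?_
  have h1 := Module.End.aeval_apply_of_hasEigenvector (p := minpoly (constField δ) (constEnd δ))
    (hasEigenvector_pow δ hu0 hu i)
  rw [minpoly.aeval, LinearMap.zero_apply, eq_comm, smul_eq_zero] at h1
  exact h1.resolve_right (pow_ne_zero _ hu0)

/-- Write `X^p - X = (X - 1) q`. By minimality `q(δ)` is nonzero, and `δ - 1` kills its image. -/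
theorem exists_eigenvector_of_minpoly [CharP L p] (δ : Der L)
    (hδ : minpoly (constField δ) (constEnd δ) = X ^ p - X) : ∃ u : L, u ≠ 0 ∧ δ u = u := by
  have hp : 1 < p := (Fact.out : p.Prime).one_lt
  have hm : (X ^ p - X : (constField δ)[X]).Monic := monic_X_pow_sub (by
    rw [degree_X]; exact_mod_cast hp)
  obtain ⟨q, hq⟩ : (X - C 1 : (constField δ)[X]) ∣ X ^ p - X := by
    rw [dvd_iff_isRoot]
    simp
  have hq0 : q ≠ 0 := by
    rintro rfl
    exact hm.ne_zero (by rw [hq, mul_zero])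
  have hlt : q.degree < (minpoly (constField δ) (constEnd δ)).degree := by
    rw [hδ, hq, degree_mul, degree_X_sub_C, degree_eq_natDegree hq0]
    exact_mod_cast (by omega : q.natDegree < 1 + q.natDegree)
  have hne : aeval (constEnd δ) q ≠ 0 := fun h => absurd hlt
    (not_lt.2 (minpoly.degree_le_of_ne_zero _ _ hq0 h))
  obtain ⟨w, hw⟩ : ∃ w, aeval (constEnd δ) q w ≠ 0 := by
    by_contra! h
    exact hne (LinearMap.ext h)
  refine ⟨_, hw, ?_⟩
  have h1 : aeval (constEnd δ) ((X - C 1) * q) w = 0 := by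
    rw [← hq, ← hδ, minpoly.aeval]
    rfl
  rw [aeval_mul, Module.End.mul_apply, map_sub, aeval_X, aeval_C, map_one, LinearMap.sub_apply,
    sub_eq_zero] at h1
  exact h1

/-- Lagrange interpolation at the prime field splits any `a` into eigenvectors. An eigenvector `b`
of eigenvalue `i` is a constant multiple of `u^i`, because the quotient rule kills `b / u^i`. -/
theorem span_pow_eigenvector_eq_top [CharP L p] (δ : Der L) (hδ : ∀ a, δ^[p] a = δ a) {u : L}
    (hu0 : u ≠ 0) (hu : δ u = u) :
    Submodule.span (constField δ) (Set.range fun i : ZMod p => u ^ i.val) = ⊤ := by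
  classical
  rw [eq_top_iff]
  rintro a -
  set v := ZMod.castHom (dvd_refl p) (constField δ) with hv
  have hinj : Set.InjOn v (Finset.univ : Finset (ZMod p)) := v.injective.injOn
  -- The Lagrange basis polynomials sum to 1; evaluated at `δ` they are the projections onto the
  -- eigenspaces.
  have hsum := congrArg (fun P => aeval (constEnd δ) P a)
    (Lagrange.sum_basis hinj Finset.univ_nonempty)
  simp only [map_sum, LinearMap.sum_apply, map_one, Module.End.one_apply] at hsum
  rw [← hsum]
  refine Submodule.sum_mem _ fun i _ => ?_
  set b := aeval (constEnd δ) (Lagrange.basis Finset.univ v i) a with hb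
  have hδb : δ b = (v i : L) * b := by
    have hdvd : (X ^ p - X : (constField δ)[X]) ∣ (X - C (v i)) * Lagrange.basis Finset.univ v i := by
      refine X_pow_sub_X_dvd_of_eval_zmod_eq_zero fun j => ?_
      rw [eval_mul]
      by_cases hij : i = j
      · simp [← hij, hv]
      · rw [Lagrange.eval_basis_of_ne hij (Finset.mem_univ j), mul_zero]
    have h0 := aeval_eq_zero_of_dvd_aeval_eq_zero hdvd
      ((aeval_constEnd_X_pow_sub_X_eq_zero_iff δ).2 hδ)
    have h1 := LinearMap.congr_fun h0 a
    rw [aeval_mul, Module.End.mul_apply, map_sub, aeval_X, aeval_C, LinearMap.sub_apply,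
      LinearMap.zero_apply, sub_eq_zero] at h1
    exact h1
  have hui : δ (u ^ i.val) = (v i : L) * u ^ i.val :=
    Module.End.mem_eigenspace_iff.1 (hasEigenvector_pow δ hu0 hu i).1
  have hc : b / u ^ i.val ∈ constField δ := by
    change δ (b / u ^ i.val) = 0
    rw [Derivation.leibniz_div, hδb, hui]
    simp only [smul_eq_mul]
    ring
  have hbu : b = (⟨_, hc⟩ : constField δ) • u ^ i.val :=
    (div_mul_cancel₀ b (pow_ne_zero _ hu0)).symm
  rw [hbu]
  exact Submodule.smul_mem _ _ (Submodule.subset_span ⟨i, rfl⟩)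

theorem finrank_constField [CharP L p] (δ : Der L) (hδ : ∀ a, δ^[p] a = δ a) {u : L}
    (hu0 : u ≠ 0) (hu : δ u = u) : Module.finrank (constField δ) L = p := by
  have hli := Module.End.eigenvectors_linearIndependent' (constEnd δ)
    (ZMod.castHom (dvd_refl p) (constField δ)) (RingHom.injective _) _
    (hasEigenvector_pow δ hu0 hu)
  rw [Module.finrank_eq_card_basis
    (Module.Basis.mk hli (span_pow_eigenvector_eq_top δ hδ hu0 hu).ge), ZMod.card]

end EigenvectorsOfDerivations

/-! ### Passage to rational functions -/

section RationalFunctions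

variable {p : ℕ} [Fact p.Prime] {K : Type*} [Field K]

theorem coeffDer_iterate_coeff (δ : Der K) (f : K[X]) (n k : ℕ) :
    ((coeffDer δ)^[n] f).coeff k = δ^[n] (f.coeff k) := by
  induction n generalizing f with
  | zero => rfl
  | succ n ih => rw [Function.iterate_succ_apply, ih, coeff_coeffDer, Function.iterate_succ_apply]

/-- Expand `a / b` to `a b^(p-1) / b^p`; a `p`-th power has derivative zero in characteristic `p`.
-/
theorem exists_eq_div_coeffDer_eq_zero (p : ℕ) [Fact p.Prime] [CharP K p] (δ : Der K)
    (r : RatFunc K) :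
    ∃ f g : K[X], g ≠ 0 ∧ coeffDer δ g = 0 ∧
      r = algebraMap K[X] (RatFunc K) f / algebraMap K[X] (RatFunc K) g := by
  have hp : p ≠ 0 := (Fact.out : p.Prime).ne_zero
  induction r using RatFunc.induction_on with | _ a b hb
  refine ⟨a * b ^ (p - 1), b ^ p, pow_ne_zero _ hb, ?_, ?_⟩
  · rw [Derivation.leibniz_pow, ← Nat.cast_smul_eq_nsmul K[X]]
    simp
  · have hb' : algebraMap K[X] (RatFunc K) b ≠ 0 := RatFunc.algebraMap_ne_zero hb
    rw [map_mul, map_pow, map_pow, div_eq_div_iff hb' (pow_ne_zero _ hb'), mul_assoc,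
      ← pow_succ, Nat.sub_add_cancel (Nat.one_le_iff_ne_zero.2 hp)]

theorem ratDer_iterate_div (δ : Der K) (f : K[X]) {g : K[X]} (hg : coeffDer δ g = 0) (n : ℕ) :
    (ratDer δ)^[n] (algebraMap K[X] (RatFunc K) f / algebraMap K[X] (RatFunc K) g) =
      algebraMap K[X] (RatFunc K) ((coeffDer δ)^[n] f) / algebraMap K[X] (RatFunc K) g := by
  have hg' : ratDer δ (algebraMap K[X] (RatFunc K) g) = 0 := by
    rw [ratDer_algebraMap, hg, map_zero]
  induction n generalizing f with
  | zero => rfl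
  | succ n ih =>
    rw [Function.iterate_succ_apply, der_div_of_const _ hg', ratDer_algebraMap, ih,
      Function.iterate_succ_apply]

theorem ratDer_iterate_eq [CharP K p] (δ : Der K) (hδ : ∀ a, δ^[p] a = δ a) (r : RatFunc K) :
    (ratDer δ)^[p] r = ratDer δ r := by
  obtain ⟨f, g, -, hg, rfl⟩ := exists_eq_div_coeffDer_eq_zero p δ r
  have h1 := ratDer_iterate_div δ f hg 1
  simp only [Function.iterate_one] at h1
  rw [ratDer_iterate_div δ f hg, h1]
  congr 2
  ext k
  rw [coeffDer_iterate_coeff, hδ, coeff_coeffDer]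

theorem coeffDer_eq_zero_iff (δ : Der K) (f : K[X]) :
    coeffDer δ f = 0 ↔ ∃ g : (constField δ)[X], g.map (constField δ).subtype = f := by
  rw [← mem_lifts, lifts_iff_coeff_lifts, Polynomial.ext_iff]
  refine forall_congr' fun n => ?_
  rw [coeff_coeffDer, coeff_zero]
  exact ⟨fun h => ⟨⟨_, h⟩, rfl⟩, fun ⟨c, hc⟩ => hc ▸ c.2⟩

theorem mem_ratSubfield_iff (F : Subfield K) (r : RatFunc K) :
    r ∈ ratSubfield F ↔ ∃ f g : F[X],
      algebraMap K[X] (RatFunc K) (f.map F.subtype) /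
        algebraMap K[X] (RatFunc K) (g.map F.subtype) = r := by
  have hdiv := fun f g => RatFunc.map_apply_div (Polynomial.mapRingHom F.subtype)
      (nonZeroDivisors_le_comap_nonZeroDivisors_of_injective _
      (Polynomial.map_injective F.subtype F.subtype.injective)) f g
  constructor
  · rintro ⟨s, rfl⟩
    induction s using RatFunc.induction_on with | _ a b hb
    exact ⟨a, b, (hdiv a b).symm⟩
  · rintro ⟨f, g, rfl⟩
    exact ⟨_, hdiv f g⟩

/-- Over a constant denominator, the derivative vanishes exactly when every coefficient of the
numerator is constant. -/
theorem constField_ratDer (p : ℕ) [Fact p.Prime] [CharP K p] (δ : Der K) :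
    constField (ratDer δ) = ratSubfield (constField δ) := by
  ext r
  rw [mem_ratSubfield_iff]
  constructor
  · intro hr
    obtain ⟨f, g, hg0, hg, rfl⟩ := exists_eq_div_coeffDer_eq_zero p δ r
    have h1 := ratDer_iterate_div δ f hg 1
    have hr' : ratDer δ (algebraMap K[X] (RatFunc K) f / algebraMap K[X] (RatFunc K) g) = 0 := hr
    simp only [Function.iterate_one] at h1
    rw [hr', eq_comm, div_eq_zero_iff, or_iff_left (RatFunc.algebraMap_ne_zero hg0),
      map_eq_zero_iff _ (RatFunc.algebraMap_injective K)] at h1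
    obtain ⟨f', rfl⟩ := (coeffDer_eq_zero_iff δ f).1 h1
    obtain ⟨g', rfl⟩ := (coeffDer_eq_zero_iff δ g).1 hg
    exact ⟨f', g', rfl⟩
  · rintro ⟨f, g, rfl⟩
    have h1 := ratDer_iterate_div δ (f.map (constField δ).subtype)
      ((coeffDer_eq_zero_iff δ _).2 ⟨g, rfl⟩) 1
    simp only [Function.iterate_one] at h1
    change ratDer δ _ = 0
    rw [h1, (coeffDer_eq_zero_iff δ _).2 ⟨f, rfl⟩, map_zero, zero_div]

end RationalFunctions

end PetitExt

namespace PetitExt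

/-! ### Differential polynomials: centrality of `t^p - t` and irreducibility -/

section DifferentialPolynomials

variable {L : Type*} [Field L]

theorem end_sub_apply (e e' : AddMonoid.End L[X]) (g : L[X]) : (e - e') g = e g - e' g := rfl

theorem end_sum_apply {ι : Type*} (s : Finset ι) (e : ι → AddMonoid.End L[X]) (g : L[X]) :
    (∑ i ∈ s, e i) g = ∑ i ∈ s, e i g :=
  AddMonoidHom.finsetSum_apply e s g

theorem coeffDer_mul_of_const (δ : Der L) {P : L[X]} (hP : coeffDer δ P = 0) (g : L[X]) :
    coeffDer δ (P * g) = P * coeffDer δ g := by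
  rw [Derivation.leibniz, hP, smul_eq_mul, smul_zero, add_zero]

theorem tMul_pow_mul_of_const (δ : Der L) {P : L[X]} (hP : coeffDer δ P = 0) (g : L[X]) (n : ℕ) :
    (tMul δ ^ n) (P * g) = P * (tMul δ ^ n) g := by
  induction n with
  | zero => rfl
  | succ n ih =>
    rw [pow_succ', end_mul_apply, ih, end_mul_apply, tMul_apply, tMul_apply,
      coeffDer_mul_of_const δ hP]
    ring

/-- Left multiplications of `L[t;δ]` are linear over the polynomials with constant coefficients. -/
theorem lMul_mul_of_const (δ : Der L) (f : L[X]) {P : L[X]} (hP : coeffDer δ P = 0) (g : L[X]) :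
    lMul δ f (P * g) = P * lMul δ f g := by
  induction f using Polynomial.induction_on' with
  | add a b ha hb => rw [lMul_add, end_add_apply, end_add_apply, ha, hb, mul_add]
  | monomial n b =>
    rw [lMul_monomial, end_mul_apply, end_mul_apply, tMul_pow_mul_of_const δ hP, cMul_apply,
      cMul_apply]
    ring

theorem lMul_sub (δ : Der L) (f g : L[X]) : lMul δ (f - g) = lMul δ f - lMul δ g := by
  rw [eq_sub_iff_add_eq, ← lMul_add, sub_add_cancel]

theorem lMul_C (δ : Der L) (a : L) (g : L[X]) : lMul δ (C a) g = C a * g := by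
  rw [← monomial_zero_left, lMul_monomial]
  rfl

theorem lMul_X_pow (δ : Der L) (n : ℕ) : lMul δ (X ^ n : L[X]) = tMul δ ^ n := by
  rw [← monomial_one_right_eq_X_pow, lMul_monomial]
  ext1 g
  simp [end_mul_apply, cMul_apply]

theorem coeffDer_X_pow_sub_X (δ : Der L) (p : ℕ) : coeffDer δ (X ^ p - X : L[X]) = 0 := by
  rw [map_sub, Derivation.leibniz_pow, coeffDer_X]
  simp

/-- Multiplication by `X` commutes with the coefficientwise derivation, and the additive
endomorphisms have characteristic `p`, so the `p`-th power of the sum is the sum of the `p`-th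
powers. -/
theorem tMul_pow_char {p : ℕ} [Fact p.Prime] [CharP L p] (δ : Der L) (g : L[X]) :
    (tMul δ ^ p) g = X ^ p * g + (coeffDer δ)^[p] g := by
  have hp : p.Prime := Fact.out
  have : Nontrivial (AddMonoid.End L[X]) := ⟨1, 0, fun h => one_ne_zero (α := L[X])
    (congrArg (fun e : AddMonoid.End L[X] => e 1) h)⟩
  have : CharP (AddMonoid.End L[X]) p := (CharP.charP_iff_prime_eq_zero hp).2 (by
    ext1 g
    change p • g = 0
    rw [← Nat.cast_smul_eq_nsmul L[X]]
    simp)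
  obtain ⟨A, hA⟩ : ∃ A : AddMonoid.End L[X], ∀ g, A g = X * g :=
    ⟨AddMonoidHom.mulLeft X, fun _ => rfl⟩
  obtain ⟨B, hB⟩ : ∃ B : AddMonoid.End L[X], ∀ g, B g = coeffDer δ g :=
    ⟨(coeffDer δ : L[X] →ₗ[ℤ] L[X]).toAddMonoidHom, fun _ => rfl⟩
  have hAB : tMul δ = A + B := by
    ext1 g
    rw [tMul_apply, end_add_apply, hA, hB]
  have hc : Commute A B := by
    ext1 g
    rw [end_mul_apply, end_mul_apply, hA, hA, hB, hB, coeffDer_mul_of_const δ (coeffDer_X δ)]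
  have h1 : ∀ n, (A ^ n) g = X ^ n * g := by
    intro n
    induction n with
    | zero => simp
    | succ n ih => rw [pow_succ', end_mul_apply, ih, pow_succ', mul_assoc, hA]
  have h2 : ∀ n, (B ^ n) g = (coeffDer δ)^[n] g := by
    intro n
    induction n with
    | zero => rfl
    | succ n ih => rw [pow_succ', end_mul_apply, ih, Function.iterate_succ_apply', hB]
  rw [hAB, add_pow_char_of_commute p hc, end_add_apply, h1, h2]

/-- `t^p - t` acts by ordinary multiplication if `δ^p = δ`. -/
theorem lMul_X_pow_sub_X {p : ℕ} [Fact p.Prime] [CharP L p] (δ : Der L)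
    (hδ : ∀ a, δ^[p] a = δ a) (g : L[X]) : lMul δ (X ^ p - X) g = (X ^ p - X) * g := by
  have h1 : lMul δ (X : L[X]) = tMul δ := by simpa using lMul_X_pow δ 1
  have h2 : (coeffDer δ)^[p] g = coeffDer δ g := by
    ext k
    rw [coeffDer_iterate_coeff, hδ, coeff_coeffDer]
  rw [lMul_sub, lMul_X_pow, h1, end_sub_apply, tMul_pow_char, h2, tMul_apply]
  ring

namespace DiffPoly

variable {δ : Der L}

theorem degree_zero : (0 : DiffPoly δ).degree = ⊥ := Polynomial.degree_zero

theorem degree_eq_bot {f : DiffPoly δ} : f.degree = ⊥ ↔ f = 0 :=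
  Polynomial.degree_eq_bot.trans (toPoly_eq_zero_iff f)

theorem degree_one : (1 : DiffPoly δ).degree = 0 := Polynomial.degree_one

theorem exists_scal_of_degree_eq_zero {f : DiffPoly δ} (hf : f.degree = 0) :
    ∃ a : L, a ≠ 0 ∧ f = scal δ a := by
  refine ⟨(toPoly f).coeff 0, ?_, eq_C_of_degree_eq_zero hf⟩
  intro h0
  have h1 : toPoly f = 0 := by
    rw [eq_C_of_degree_eq_zero (show (toPoly f).degree = 0 from hf), h0, C_0]
  rw [toPoly_eq_zero_iff] at h1
  rw [h1, degree_zero] at hf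
  exact absurd hf (by simp)

theorem scal_mul_scal (a b : L) : scal δ a * scal δ b = scal δ (a * b) := by
  apply toPoly.injective
  rw [toPoly_mul]
  exact (lMul_C δ a (C b)).trans C_mul.symm

theorem scal_one : scal δ (1 : L) = 1 := rfl

instance : NoZeroDivisors (DiffPoly δ) where
  eq_zero_or_eq_zero_of_mul_eq_zero {f g} h := by
    rw [← degree_eq_bot, degree_mul, WithBot.add_eq_bot] at h
    exact h.imp degree_eq_bot.1 degree_eq_bot.1

theorem isUnit_iff_degree_eq_zero {f : DiffPoly δ} : IsUnit f ↔ f.degree = 0 := by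
  constructor
  · rintro ⟨u, rfl⟩
    have h := congrArg degree u.mul_inv
    rw [degree_mul, degree_one] at h
    exact (Nat.WithBot.add_eq_zero_iff.1 h).1
  · intro h
    obtain ⟨a, ha, rfl⟩ := exists_scal_of_degree_eq_zero h
    refine ⟨⟨scal δ a, scal δ a⁻¹, ?_, ?_⟩, rfl⟩
    · rw [scal_mul_scal, mul_inv_cancel₀ ha, scal_one]
    · rw [scal_mul_scal, inv_mul_cancel₀ ha, scal_one]

theorem toPoly_t_pow (n : ℕ) : toPoly (t δ ^ n) = X ^ n := by
  induction n with
  | zero => rfl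
  | succ n ih =>
    have h1 : lMul δ (X : L[X]) = tMul δ := by simpa using lMul_X_pow δ 1
    rw [pow_succ', toPoly_mul, ih, show toPoly (t δ) = X from rfl, h1, tMul_apply,
      Derivation.leibniz_pow, coeffDer_X]
    simp [pow_succ']

/-- Makes the multiplication of a Petit algebra bilinear over the constants. -/
theorem smul_mul_comm_of_const {c : L} (hc : δ c = 0) (f g : DiffPoly δ) :
    f * (c • g) = c • (f * g) := by
  apply toPoly.injective
  rw [toPoly_mul, toPoly.map_smul, toPoly.map_smul, toPoly_mul, smul_eq_C_mul, smul_eq_C_mul]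
  exact lMul_mul_of_const δ _ (by rw [coeffDer_C, hc, C_0]) _

section Frobenius

variable {p : ℕ} [Fact p.Prime] [CharP L p]

/-- `t^p - t` is central if `δ^p = δ`. -/
theorem t_pow_sub_t_comm (hδ : ∀ a, δ^[p] a = δ a) (g : DiffPoly δ) :
    (t δ ^ p - t δ) * g = g * (t δ ^ p - t δ) := by
  have hz : toPoly (t δ ^ p - t δ) = X ^ p - X := by
    rw [map_sub, toPoly_t_pow]
    rfl
  apply toPoly.injective
  rw [toPoly_mul, toPoly_mul, hz, lMul_X_pow_sub_X δ hδ]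
  -- Right multiplication by `t^p - t` is also the ordinary product with `X^p - X`, as that
  -- polynomial has constant coefficients.
  have h := lMul_mul_of_const δ (toPoly g) (coeffDer_X_pow_sub_X δ p) 1
  rw [mul_one, lMul_one] at h
  exact h.symm

end Frobenius

/-- With the next lemma, this computes `t^n d = d t^n + n δ(d) t^(n-1) + …`, of which only the two
top terms are needed. -/
theorem coeff_tMul_pow_C_self (δ : Der L) (d : L) (n : ℕ) :
    ((tMul δ ^ n) (C d)).coeff n = d ∧ ∀ k, n < k → ((tMul δ ^ n) (C d)).coeff k = 0 := by
  induction n with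
  | zero =>
    refine ⟨by simp, fun k hk => ?_⟩
    simp [coeff_C, hk.ne']
  | succ n ih =>
    rw [pow_succ', end_mul_apply, tMul_apply]
    refine ⟨?_, fun k hk => ?_⟩
    · rw [coeff_add, coeff_X_mul, ih.1, coeff_coeffDer, ih.2 _ n.lt_succ_self, map_zero, add_zero]
    · obtain ⟨k, rfl⟩ : ∃ j, k = j + 1 := ⟨k - 1, by omega⟩
      rw [coeff_add, coeff_X_mul, coeff_coeffDer, ih.2 _ (by omega), ih.2 _ (by omega), map_zero,
        add_zero]

theorem coeff_tMul_pow_succ_C (δ : Der L) (d : L) (n : ℕ) :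
    ((tMul δ ^ (n + 1)) (C d)).coeff n = (n + 1) * δ d := by
  induction n with
  | zero => simp [tMul_apply, coeffDer_C]
  | succ n ih =>
    rw [pow_succ', end_mul_apply, tMul_apply, coeff_add, coeff_X_mul, ih, coeff_coeffDer,
      (coeff_tMul_pow_C_self δ d (n + 1)).1]
    push_cast
    ring

theorem coeff_lMul_C (δ : Der L) (d : L) {B : L[X]} {m : ℕ} (hB : B.natDegree = m + 1) :
    (lMul δ B (C d)).coeff (m + 1) = B.coeff (m + 1) * d ∧
      (lMul δ B (C d)).coeff m = B.coeff m * d + B.coeff (m + 1) * ((m + 1) * δ d) := by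
  have h : ∀ k, (lMul δ B (C d)).coeff k =
      ∑ i ∈ Finset.range (m + 2), B.coeff i * ((tMul δ ^ i) (C d)).coeff k := by
    intro k
    rw [lMul, sum_over_range _ (fun n => by rw [cMul_zero, zero_mul]), hB,
      end_sum_apply, finsetSum_coeff]
    refine Finset.sum_congr rfl fun i _ => ?_
    rw [end_mul_apply, cMul_apply, coeff_C_mul]
  have h0 : ∀ k, m ≤ k → ∑ i ∈ Finset.range m, B.coeff i * ((tMul δ ^ i) (C d)).coeff k = 0 := by
    intro k hk
    refine Finset.sum_eq_zero fun i hi => ?_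
    rw [(coeff_tMul_pow_C_self δ d i).2 k ((Finset.mem_range.1 hi).trans_le hk), mul_zero]
  rw [h, h, Finset.sum_range_succ, Finset.sum_range_succ, Finset.sum_range_succ,
    Finset.sum_range_succ, h0 _ le_rfl, h0 _ m.le_succ, (coeff_tMul_pow_C_self δ d (m + 1)).1,
    (coeff_tMul_pow_C_self δ d m).1, (coeff_tMul_pow_C_self δ d m).2 _ m.lt_succ_self,
    coeff_tMul_pow_succ_C]
  constructor <;> ring

/-- If right multiplication of `b` by the scalar `d` stays in the left ideal of `b`, then the degree
of `b` is zero in `L`, unless `d` is constant. -/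
theorem natDegree_mul_der_eq_zero {b u : DiffPoly δ} (hb : b ≠ 0) {d : L} (hd : d ≠ 0)
    (h : b * scal δ d = u * b) : ((toPoly b).natDegree : L) * δ d = 0 := by
  have hb' : toPoly b ≠ 0 := mt (toPoly_eq_zero_iff b).1 hb
  -- Degrees add, so `u` is a nonzero scalar `e`.
  have hu : u.degree = 0 := by
    have h1 := congrArg degree h
    have h2 : (scal δ d).degree = 0 := Polynomial.degree_C hd
    rw [degree_mul, degree_mul, h2, add_zero] at h1
    have h3 : u ≠ 0 := by
      rintro rfl
      rw [degree_zero, WithBot.bot_add, degree_eq_bot] at h1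
      exact hb h1
    have h3' : toPoly u ≠ 0 := mt (toPoly_eq_zero_iff u).1 h3
    rw [degree, degree, degree_eq_natDegree hb', degree_eq_natDegree h3'] at h1
    rw [degree, degree_eq_natDegree h3']
    norm_cast at h1 ⊢
    omega
  obtain ⟨e, -, rfl⟩ := exists_scal_of_degree_eq_zero hu
  cases hm : (toPoly b).natDegree with
  | zero => simp
  | succ m =>
    have h1 : lMul δ (toPoly b) (C d) = C e * toPoly b :=
      (congrArg toPoly h).trans (lMul_C δ e _)
    obtain ⟨h2, h3⟩ := coeff_lMul_C δ d hm
    rw [h1, coeff_C_mul] at h2 h3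
    have hlc : (toPoly b).coeff (m + 1) ≠ 0 := by
      rw [← hm]
      exact leadingCoeff_ne_zero.2 hb'
    -- Leading coefficients force `e = d`; the next coefficients then leave only the term `(m + 1)
    -- δ(d)`, times the leading coefficient.
    have he : e = d := mul_right_cancel₀ hlc (h2.trans (mul_comm _ _))
    rw [he, mul_comm d, left_eq_add] at h3
    push_cast
    exact (mul_eq_zero.1 h3).resolve_left hlc

section CyclicPoly

variable {p : ℕ} [Fact p.Prime] {δ : Der L} {d : L}

theorem toPoly_cyclicPoly (p : ℕ) (δ : Der L) (d : L) :
    toPoly (cyclicPoly p δ d) = X ^ p - X - C d := by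
  rw [cyclicPoly, map_sub, map_sub, toPoly_t_pow]
  rfl

theorem degree_cyclicPoly (p : ℕ) [Fact p.Prime] (δ : Der L) (d : L) :
    (cyclicPoly p δ d).degree = p := by
  have hp : 1 < p := (Fact.out : p.Prime).one_lt
  rw [degree, toPoly_cyclicPoly, sub_sub, degree_sub_eq_left_of_degree_lt, degree_X_pow]
  rw [degree_X_pow, degree_X_add_C]
  exact_mod_cast hp

theorem cyclicPoly_ne_zero (p : ℕ) [Fact p.Prime] (δ : Der L) (d : L) : cyclicPoly p δ d ≠ 0 := by
  intro h
  have h1 := degree_cyclicPoly p δ d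
  rw [h, DiffPoly.degree_zero] at h1
  exact absurd h1 (by simp)

theorem natDegree_cyclicPoly (p : ℕ) [Fact p.Prime] (δ : Der L) (d : L) :
    (toPoly (cyclicPoly p δ d)).natDegree = p :=
  natDegree_eq_of_degree_eq_some (degree_cyclicPoly p δ d)

variable [CharP L p]

/-- `f t = t f + δ(d)` for `f = t^p - t - d`. -/
theorem cyclicPoly_mul_t (hδ : ∀ a, δ^[p] a = δ a) (d : L) :
    cyclicPoly p δ d * t δ = t δ * cyclicPoly p δ d + scal δ (δ d) := by
  rw [cyclicPoly, sub_mul, mul_sub, t_pow_sub_t_comm hδ, t_mul_scal]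
  abel

/-- For a factorization `f = a b`, centrality of `t^p - t` shows that `R b` is stable under right
multiplication by `d`, which forces `p ∣ deg b`. -/
theorem irreducible_cyclicPoly (hδ : ∀ a, δ^[p] a = δ a) (hd : δ d ≠ 0) :
    Irreducible (cyclicPoly p δ d) := by
  have hd0 : d ≠ 0 := by
    rintro rfl
    exact hd (map_zero δ)
  have hdeg := degree_cyclicPoly p δ d
  refine ⟨?_, fun {a b} hab => ?_⟩
  · rw [isUnit_iff_degree_eq_zero, hdeg]
    exact_mod_cast (Fact.out : p.Prime).ne_zero
  · have hne := cyclicPoly_ne_zero p δ d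
    have hb : b ≠ 0 := by
      rintro rfl
      exact hne (by rw [hab, mul_zero])
    have ha : a ≠ 0 := by
      rintro rfl
      exact hne (by rw [hab, zero_mul])
    have hb' : toPoly b ≠ 0 := mt (toPoly_eq_zero_iff b).1 hb
    have ha' : toPoly a ≠ 0 := mt (toPoly_eq_zero_iff a).1 ha
    -- Here `d = (t^p - t) - f`: the first term moves past `b`, and `b f = b a b`.
    have hcomm : b * scal δ d = (t δ ^ p - t δ - b * a) * b := by
      rw [sub_mul, t_pow_sub_t_comm hδ, mul_assoc, ← hab, cyclicPoly, mul_sub b _ (scal δ d)]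
      abel
    have h1 := natDegree_mul_der_eq_zero hb hd0 hcomm
    have h2 := (CharP.cast_eq_zero_iff L p _).1 ((mul_eq_zero.1 h1).resolve_right hd)
    rw [hab, degree_mul, degree, degree, degree_eq_natDegree ha', degree_eq_natDegree hb'] at hdeg
    rw [isUnit_iff_degree_eq_zero, isUnit_iff_degree_eq_zero, degree, degree,
      degree_eq_natDegree ha', degree_eq_natDegree hb']
    norm_cast at hdeg ⊢
    -- As `deg a + deg b = p` and `p ∣ deg b`, one of the two degrees is zero.
    obtain ⟨k, hk⟩ := h2
    rcases Nat.eq_zero_or_pos k with h0 | h0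
    · right
      rw [hk, h0, mul_zero]
    · left
      nlinarith

end CyclicPoly

end DiffPoly

end DifferentialPolynomials

end PetitExt

namespace PetitExt

/-! ### Petit algebras of irreducible polynomials are division algebras -/

section DivisionAlgebras

variable {L : Type*} [Field L] {δ : Der L}

namespace DiffPoly

/-- A Bézout identity for an irreducible `f` and a nonzero `h` of smaller degree. -/
theorem exists_mul_add_mul_eq_one {f h : DiffPoly δ} (hf : Irreducible f) (hh : h ≠ 0)
    (hdeg : h.degree < f.degree) : ∃ u v : DiffPoly δ, u * h + v * f = 1 := by
  -- A nonzero element of least degree in the left ideal `R h + R f`; by minimality it divides `f`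
  -- on the right.
  obtain ⟨w, ⟨hw0, u, v, hw⟩, hmin⟩ := (InvImage.wf (degree (δ := δ)) wellFounded_lt).has_min
    {w | w ≠ 0 ∧ ∃ u v, u * h + v * f = w} ⟨h, hh, 1, 0, by rw [one_mul, zero_mul, add_zero]⟩
  obtain ⟨r, hr, q, hq⟩ := exists_rightDiv w hw0 f
  have hr0 : r = 0 := by
    by_contra hne
    refine hmin r ⟨hne, -(q * u), 1 - q * v, ?_⟩ hr
    rw [eq_sub_of_add_eq' hq.symm, ← hw]
    noncomm_ring
  rw [hr0, add_zero] at hq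
  -- If the cofactor were a unit, `w` would have the degree of `f`, but `h` lies in the ideal and
  -- has smaller degree.
  rcases hf.isUnit_or_isUnit hq with h1 | h1
  · rw [isUnit_iff_degree_eq_zero] at h1
    refine absurd ?_ (hmin h ⟨hh, 1, 0, by rw [one_mul, zero_mul, add_zero]⟩)
    have h2 := congrArg degree hq
    rw [degree_mul, h1, zero_add] at h2
    rwa [h2] at hdeg
  · obtain ⟨e, rfl⟩ := h1
    refine ⟨↑e⁻¹ * u, ↑e⁻¹ * v, ?_⟩
    rw [mul_assoc, mul_assoc, ← mul_add, hw, Units.inv_mul]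

end DiffPoly

open DiffPoly

namespace PetitAlgebra

variable {f : DiffPoly δ}

/-- The coefficients of an element of a Petit algebra. -/
noncomputable def equivDegreeLT (f : DiffPoly δ) : PetitAlgebra f ≃ₗ[L]
    degreeLT L (toPoly f).natDegree :=
  LinearEquiv.ofSubmodule' (toPoly : DiffPoly δ ≃ₗ[L] L[X]) _

theorem finrank_eq (f : DiffPoly δ) :
    Module.finrank L (PetitAlgebra f) = (toPoly f).natDegree := by
  rw [((equivDegreeLT f).trans (degreeLTEquiv L _)).finrank_eq, Module.finrank_fin_fun]

instance (f : DiffPoly δ) : Module.Finite L (PetitAlgebra f) :=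
  Module.Finite.equiv ((equivDegreeLT f).trans (degreeLTEquiv L _)).symm

theorem val_mul (a b : PetitAlgebra f) : (a * b).1 = modR f (a.1 * b.1) := rfl

theorem ext_val {a b : PetitAlgebra f} (h : a.1 = b.1) : a = b := Subtype.ext h

theorem val_eq_zero_iff (a : PetitAlgebra f) : a.1 = 0 ↔ a = 0 :=
  ⟨fun h => ext_val h, fun h => by rw [h]; rfl⟩

theorem degree_val_lt (hf : f ≠ 0) (a : PetitAlgebra f) : a.1.degree < f.degree :=
  (mem_remainders f hf _).1 a.2

/-- If `a`, `b`, `c` associate in a Petit algebra and `q` is the quotient of `a b` by `f`, then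
`q f c` lies in the left ideal of `f`. -/
theorem exists_mul_eq_mul_of_assoc (hf : f ≠ 0) {a b c : PetitAlgebra f}
    (h : a * b * c = a * (b * c)) {q r : DiffPoly δ} (hr : r.degree < f.degree)
    (hab : a.1 * b.1 = q * f + r) : ∃ q', q * (f * c.1) = q' * f := by
  have h' : modR f (r * c.1) = modR f (a.1 * modR f (b.1 * c.1)) := by
    have h1 := congrArg Subtype.val h
    rw [val_mul, val_mul, val_mul, val_mul, modR_eq f hr hab] at h1
    exact h1
  obtain ⟨q₁, h1⟩ := (modR_spec f hf (r * c.1)).2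
  obtain ⟨q₂, h2⟩ := (modR_spec f hf (b.1 * c.1)).2
  obtain ⟨q₃, h3⟩ := (modR_spec f hf (a.1 * modR f (b.1 * c.1))).2
  refine ⟨a.1 * q₂ + q₃ - q₁, ?_⟩
  have h4 : q * (f * c.1) = a.1 * (b.1 * c.1) - r * c.1 := by
    rw [← mul_assoc, ← mul_assoc, hab, add_mul, add_sub_cancel_right]
  have h5 : a.1 * (b.1 * c.1) =
      a.1 * (q₂ * f) + (q₃ * f + modR f (a.1 * modR f (b.1 * c.1))) := by
    conv_lhs => rw [h2, mul_add, h3]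
  rw [h4, h1, h', h5]
  noncomm_ring

/-- Petit algebras of irreducible differential polynomials have no zero divisors. -/
theorem eq_zero_or_eq_zero_of_mul_eq_zero (hf : Irreducible f) (g h : PetitAlgebra f)
    (hgh : g * h = 0) : g = 0 ∨ h = 0 := by
  by_contra! hne
  obtain ⟨hg0, hh0⟩ := hne
  rw [← (val_eq_zero_iff _).ne] at hg0 hh0
  have hgdeg := degree_val_lt hf.ne_zero g
  have hhdeg := degree_val_lt hf.ne_zero h
  obtain ⟨u, v, huv⟩ := exists_mul_add_mul_eq_one hf hh0 hhdeg
  have hmem : ∃ q, g.1 * h.1 = q * f := by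
    obtain ⟨q, hq⟩ := (modR_spec f hf.ne_zero (g.1 * h.1)).2
    rw [← val_mul, hgh] at hq
    exact ⟨q, hq.trans (add_zero _)⟩
  -- Choose `w` of least degree with `w h ∈ R f`; the candidate `g` shows `deg w < deg f`.
  obtain ⟨w, ⟨hw0, q₁, hw⟩, hmin⟩ := (InvImage.wf (degree (δ := δ)) wellFounded_lt).has_min
    {w | w ≠ 0 ∧ ∃ q, w * h.1 = q * f} ⟨g.1, hg0, hmem⟩
  have hwdeg : w.degree < f.degree :=
    (not_lt.1 (hmin g.1 ⟨hg0, hmem⟩)).trans_lt hgdeg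
  let φ : PetitAlgebra w →ₗ[L] PetitAlgebra f :=
    { toFun := fun r => ⟨modR f (r.1 * h.1), modR_mem f _⟩
      map_add' := fun r s => ext_val (by
        change modR f ((r.1 + s.1) * h.1) = modR f (r.1 * h.1) + modR f (s.1 * h.1)
        rw [add_mul, modR_add])
      map_smul' := fun c r => ext_val (by
        change modR f ((c • r.1) * h.1) = c • modR f (r.1 * h.1)
        rw [smul_mul_assoc, modR_smul]) }
  -- By Bézout, `s = (s u) h + (s v) f`. Reducing `s u` modulo `w` changes the product with `h` only
  -- by an element of `R f`. Surjectivity gives `deg f ≤ deg w`, a contradiction.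
  have hφ : Function.Surjective φ := by
    intro s
    obtain ⟨q₂, hq₂⟩ := (modR_spec w hw0 (s.1 * u)).2
    refine ⟨⟨modR w (s.1 * u), modR_mem w _⟩, ext_val ?_⟩
    refine modR_eq f (q := -(q₂ * q₁ + s.1 * v)) (degree_val_lt hf.ne_zero s) ?_
    change modR w (s.1 * u) * h.1 = _
    have h1 : s.1 * (u * h.1 + v * f) = s.1 := by rw [huv, mul_one]
    rw [eq_sub_of_add_eq' hq₂.symm, sub_mul, mul_assoc q₂, hw]
    refine Eq.trans ?_ (congrArg (-(q₂ * q₁ + s.1 * v) * f + ·) h1)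
    noncomm_ring
  have hle := LinearMap.finrank_le_finrank_of_surjective hφ
  rw [finrank_eq, finrank_eq] at hle
  exact absurd (natDegree_lt_natDegree (mt (toPoly_eq_zero_iff w).1 hw0) hwdeg) (not_lt.2 hle)

theorem mul_smul_of_const {c : L} (hc : δ c = 0) (a b : PetitAlgebra f) :
    a * (c • b) = c • (a * b) := ext_val (by
  change modR f (a.1 * (c • b.1)) = c • modR f (a.1 * b.1)
  rw [smul_mul_comm_of_const hc, modR_smul])

/-- Injective endomorphisms of finite-dimensional spaces are bijective. Right multiplications are
`L`-linear, but left multiplications are in general linear only over the constants, hence the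
finiteness of `L` over them. -/
theorem isDivisionAlgebra (hf : Irreducible f)
    [Module.Finite (constField δ) L] : IsDivisionAlgebra (constField δ) (PetitAlgebra f) := by
  have : Module.Finite (constField δ) (PetitAlgebra f) := Module.Finite.trans L _
  have hmul := eq_zero_or_eq_zero_of_mul_eq_zero hf
  refine ⟨fun c a b => smul_mul_assoc (c : L) a b, fun c a b => mul_smul_of_const c.2 a b, ?_,
    fun a ha => ?_, fun a ha => ?_⟩
  · refine Module.nontrivial_of_finrank_pos (R := L) ?_
    rw [finrank_eq, Nat.pos_iff_ne_zero]
    intro h0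
    refine hf.not_isUnit (isUnit_iff_degree_eq_zero.2 ?_)
    rw [DiffPoly.degree, degree_eq_natDegree (mt (toPoly_eq_zero_iff f).1 hf.ne_zero), h0, Nat.cast_zero]
  · let φ : PetitAlgebra f →ₗ[constField δ] PetitAlgebra f :=
      { toFun := fun b => a * b
        map_add' := mul_add a
        map_smul' := fun c b => mul_smul_of_const c.2 a b }
    have hφ : Function.Injective φ := (injective_iff_map_eq_zero φ).2 fun b hb =>
      (hmul a b hb).resolve_left ha
    exact ⟨hφ, LinearMap.surjective_of_injective hφ⟩
  · let φ : PetitAlgebra f →ₗ[L] PetitAlgebra f :=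
      { toFun := fun b => b * a
        map_add' := fun b c => add_mul b c a
        map_smul' := fun c b => smul_mul_assoc c b a }
    have hφ : Function.Injective φ := (injective_iff_map_eq_zero φ).2 fun b hb =>
      (hmul b a hb).resolve_right ha
    exact ⟨hφ, LinearMap.surjective_of_injective hφ⟩

end PetitAlgebra

end DivisionAlgebras

/-! ### Translations `t ↦ t + c`, nonassociativity and the cyclic extension -/

section Translations

variable {L : Type*} [Field L] {δ : Der L}

theorem coeffDer_X_add_C_pow {c : L} (hc : δ c = 0) (n : ℕ) :
    coeffDer δ ((X + C c) ^ n) = 0 := by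
  rw [Derivation.leibniz_pow, map_add, coeffDer_X, coeffDer_C, hc]
  simp

theorem coeffDer_taylor {c : L} (hc : δ c = 0) (g : L[X]) :
    coeffDer δ (taylor c g) = taylor c (coeffDer δ g) := by
  induction g using Polynomial.induction_on' with
  | add a b ha hb => simp only [map_add, ha, hb]
  | monomial n b =>
    rw [taylor_monomial, mul_comm, coeffDer_mul_of_const δ (coeffDer_X_add_C_pow hc n), coeffDer_C,
      coeffDer_monomial, taylor_monomial, mul_comm]

theorem lMul_X_add_C (δ : Der L) (c : L) (g : L[X]) :
    lMul δ (X + C c) g = (X + C c) * g + coeffDer δ g := by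
  have h1 : lMul δ (X : L[X]) = tMul δ := by simpa using lMul_X_pow δ 1
  rw [lMul_add, end_add_apply, h1, lMul_C, tMul_apply]
  ring

/-- Ordinary powers of `X + c` have constant coefficients, so they agree with its powers in
`L[t;δ]`. -/
theorem lMul_X_add_C_pow {c : L} (hc : δ c = 0) (n : ℕ) :
    lMul δ ((X + C c) ^ n) = lMul δ (X + C c) ^ n := by
  induction n with
  | zero => rw [pow_zero, pow_zero, one_lMul]
  | succ n ih =>
    have h : (X + C c) ^ (n + 1) = lMul δ (X + C c) ((X + C c) ^ n) := by
      rw [lMul_X_add_C, coeffDer_X_add_C_pow hc, add_zero, pow_succ']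
    rw [h, lMul_lMul, ih, ← pow_succ']

theorem lMul_taylor_monomial {c : L} (hc : δ c = 0) (n : ℕ) (b : L) :
    lMul δ (taylor c (monomial n b)) = cMul b * lMul δ (X + C c) ^ n := by
  rw [taylor_monomial, ← cMul_apply, lMul_cMul, lMul_X_add_C_pow hc]

/-- The substitution `t ↦ t + c` by a constant `c` is multiplicative on `L[t;δ]`. -/
theorem taylor_lMul {c : L} (hc : δ c = 0) (f g : L[X]) :
    taylor c (lMul δ f g) = lMul δ (taylor c f) (taylor c g) := by
  -- The translation intertwines left multiplication by `t` with left multiplication by `t + c`.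
  have ht : ∀ n, taylor c ((tMul δ ^ n) g) = (lMul δ (X + C c) ^ n) (taylor c g) := by
    intro n
    induction n with
    | zero => rfl
    | succ n ih =>
      rw [pow_succ', pow_succ', end_mul_apply, end_mul_apply, ← ih, lMul_X_add_C, tMul_apply,
        coeffDer_taylor hc, map_add, taylor_mul, taylor_X]
  induction f using Polynomial.induction_on' with
  | add a b ha hb => rw [lMul_add, end_add_apply, map_add, ha, hb, map_add, lMul_add, end_add_apply]
  | monomial n b =>
    rw [lMul_monomial, lMul_taylor_monomial hc, end_mul_apply, end_mul_apply, cMul_apply,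
      cMul_apply, taylor_mul, taylor_C, ht]

namespace DiffPoly

/-- The substitution `t ↦ t + c`. -/
noncomputable def shift (c : L) : DiffPoly δ →ₗ[L] DiffPoly δ :=
  toPoly.symm.toLinearMap ∘ₗ taylor c ∘ₗ toPoly.toLinearMap

theorem toPoly_shift (c : L) (f : DiffPoly δ) :
    toPoly (shift c f) = taylor c (toPoly f) := rfl

theorem shift_mul {c : L} (hc : δ c = 0) (f g : DiffPoly δ) :
    shift c (f * g) = shift c f * shift c g :=
  taylor_lMul hc _ _

theorem degree_shift (c : L) (f : DiffPoly δ) : (shift c f).degree = f.degree :=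
  degree_taylor _ _

theorem shift_zero (f : DiffPoly δ) : shift 0 f = f := taylor_zero _

theorem shift_shift (c d : L) (f : DiffPoly δ) :
    shift c (shift d f) = shift (c + d) f := taylor_taylor _ _ _

/-- By Frobenius, `(t + c)^p - (t + c) = t^p - t` when `c^p = c`. -/
theorem shift_cyclicPoly {p : ℕ} [Fact p.Prime] [CharP L p] {c : L} (hc : c ^ p = c) (d : L) :
    shift c (cyclicPoly p δ d) = cyclicPoly p δ d := by
  apply toPoly.injective
  rw [toPoly_shift, toPoly_cyclicPoly, map_sub, map_sub, taylor_C, taylor_X_pow, taylor_X,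
    add_pow_char, ← C_pow, hc]
  ring

/-- Translating `g = q f + r` yields another right division by `f`, as `f` is fixed and degrees are
kept. -/
theorem modR_shift {c : L} (hc : δ c = 0) {f : DiffPoly δ} (hf0 : f ≠ 0)
    (hf : shift c f = f) (g : DiffPoly δ) :
    modR f (shift c g) = shift c (modR f g) := by
  obtain ⟨h1, q, h2⟩ := modR_spec f hf0 g
  refine modR_eq f (q := shift c q) (by rwa [degree_shift]) ?_
  conv_lhs => rw [h2, map_add, shift_mul hc, hf]

end DiffPoly

open DiffPoly

namespace PetitAlgebra

variable {f : DiffPoly δ}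

/-- The translation `t ↦ t + c` as an automorphism of a Petit algebra. -/
noncomputable def shiftAut {c : L} (hc : δ c = 0) (hf0 : f ≠ 0) (hf : shift c f = f) :
    RingAut (PetitAlgebra f) where
  toFun a := ⟨shift c a.1, (mem_remainders f hf0 _).2 (by
    rw [degree_shift]; exact degree_val_lt hf0 a)⟩
  invFun a := ⟨shift (-c) a.1, (mem_remainders f hf0 _).2 (by
    rw [degree_shift]; exact degree_val_lt hf0 a)⟩
  left_inv a := ext_val (by
    change shift (-c) (shift c a.1) = a.1
    rw [shift_shift, neg_add_cancel, shift_zero])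
  right_inv a := ext_val (by
    change shift c (shift (-c) a.1) = a.1
    rw [shift_shift, add_neg_cancel, shift_zero])
  map_add' a b := ext_val (map_add (shift c) a.1 b.1)
  map_mul' a b := ext_val (by
    change shift c (modR f (a.1 * b.1)) = modR f (shift c a.1 * shift c b.1)
    rw [← shift_mul hc, modR_shift hc hf0 hf])

theorem val_shiftAut_pow {c : L} (hc : δ c = 0) (hf0 : f ≠ 0) (hf : shift c f = f)
    (n : ℕ) (a : PetitAlgebra f) :
    ((shiftAut hc hf0 hf ^ n) a).1 = shift (n * c) a.1 := by
  induction n with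
  | zero => rw [Nat.cast_zero, zero_mul, shift_zero]; rfl
  | succ n ih =>
    rw [pow_succ']
    change shift c ((shiftAut hc hf0 hf ^ n) a).1 = _
    rw [ih, shift_shift]
    congr 2
    push_cast
    ring

end PetitAlgebra

section CyclicExtensions

variable {p : ℕ} [Fact p.Prime] [CharP L p]

/-- The `n`-th power is `t ↦ t + n`, trivial for `n = p`, whereas `t` itself is moved by `n = 1`. -/
theorem orderOf_shiftAut_one (d : L) (h1 : δ 1 = 0)
    (hf : shift 1 (cyclicPoly p δ d) = cyclicPoly p δ d) :
    orderOf (PetitAlgebra.shiftAut h1 (cyclicPoly_ne_zero p δ d) hf) = p := by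
  refine orderOf_eq_prime ?_ fun h => ?_
  · refine RingEquiv.ext fun a => PetitAlgebra.ext_val ?_
    rw [PetitAlgebra.val_shiftAut_pow, CharP.cast_eq_zero, zero_mul, shift_zero]
    rfl
  · have ht : t δ ∈ remainders (cyclicPoly p δ d) := by
      rw [mem_remainders _ (cyclicPoly_ne_zero p δ d), degree_cyclicPoly]
      change (X : L[X]).degree < p
      rw [degree_X]
      exact_mod_cast (Fact.out : p.Prime).one_lt
    have h2 := congrArg (fun a => toPoly a.1) (RingEquiv.congr_fun h
      (⟨t δ, ht⟩ : PetitAlgebra (cyclicPoly p δ d)))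
    have h3 : taylor 1 (X : L[X]) = X := h2
    rw [taylor_X, add_eq_left] at h3
    exact one_ne_zero h3

theorem CyclicExt.not_assoc (hδ : ∀ a, δ^[p] a = δ a) {d : L} (hd : δ d ≠ 0) :
    ¬ ∀ a b c : CyclicExt p δ d, a * b * c = a * (b * c) := by
  intro hassoc
  have hp := (Fact.out : p.Prime)
  have hf0 : cyclicPoly p δ d ≠ 0 := cyclicPoly_ne_zero p δ d
  have hfd : (cyclicPoly p δ d).degree = p := degree_cyclicPoly p δ d
  have hmem : ∀ n < p, t δ ^ n ∈ remainders (cyclicPoly p δ d) := by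
    intro n hn
    rw [mem_remainders _ hf0, hfd, DiffPoly.degree, toPoly_t_pow, degree_X_pow]
    exact_mod_cast hn
  have ht : t δ ∈ remainders (cyclicPoly p δ d) := by simpa using hmem 1 hp.one_lt
  -- The triple `t^(p-1), t, t` works: `t^p = 1 · f + (t + d)` has quotient 1, so associativity
  -- would put `f t` in `R f`.
  obtain ⟨q, hq⟩ := PetitAlgebra.exists_mul_eq_mul_of_assoc hf0
    (hassoc ⟨_, hmem (p - 1) (Nat.sub_lt hp.pos one_pos)⟩ ⟨_, ht⟩ ⟨_, ht⟩) (q := 1)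
    (r := t δ + scal δ d) (by
      rw [hfd, DiffPoly.degree, map_add]
      change (X + C d).degree < (p : WithBot ℕ)
      rw [degree_X_add_C]
      exact_mod_cast hp.one_lt) (by
      change t δ ^ (p - 1) * t δ = _
      rw [← pow_succ, Nat.sub_add_cancel hp.one_lt.le, cyclicPoly]
      noncomm_ring)
  change 1 * (cyclicPoly p δ d * t δ) = _ at hq
  -- Subtracting `t f` leaves the nonzero scalar `δ(d)` as a left multiple of `f`, impossible by
  -- degree.
  rw [one_mul, cyclicPoly_mul_t hδ, ← eq_sub_iff_add_eq', ← sub_mul] at hq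
  have hdeg := congrArg DiffPoly.degree hq
  have h0 : (scal δ (δ d)).degree = 0 := Polynomial.degree_C hd
  rw [h0, DiffPoly.degree_mul, hfd, eq_comm, Nat.WithBot.add_eq_zero_iff] at hdeg
  exact hp.ne_zero (by exact_mod_cast hdeg.2)

theorem CyclicExt.isNonassocCyclicExtension {d : L}
    (hdiv : IsDivisionAlgebra (constField δ) (CyclicExt p δ d)) :
    IsNonassocCyclicExtension p (constField δ) L (CyclicExt p δ d) where
  division := hdiv
  embed_injective := by
    have := hdiv.nontrivial
    exact smul_left_injective L one_ne_zero
  embed_mul a b := by rw [smul_mul_assoc, one_mul, mul_smul]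
  smul_eq_embed_mul a y := by rw [smul_mul_assoc, one_mul]
  finrank_eq := by rw [PetitAlgebra.finrank_eq, natDegree_cyclicPoly]
  exists_cyclic := by
    have h1 : δ 1 = 0 := δ.map_one_eq_zero
    have hf := shift_cyclicPoly (δ := δ) (one_pow p) d
    set σ := PetitAlgebra.shiftAut h1 (cyclicPoly_ne_zero p δ d) hf
    -- Linearity over all of `L` gives both linearity over the constants and the fixing of `L · 1`.
    have hL : Subgroup.zpowers σ ≤ algAut L (CyclicExt p δ d) := Subgroup.zpowers_le.2 fun c a =>
      PetitAlgebra.ext_val (map_smul (shift 1) c a.1)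
    refine ⟨Subgroup.zpowers σ, fun τ hτ c a => hL hτ (c : L) a, inferInstance, ?_, fun τ hτ a => ?_⟩
    · rw [Nat.card_zpowers, orderOf_shiftAut_one]
    · rw [hL hτ a 1, map_one]

end CyclicExtensions

end Translations

end PetitExt

theorem mainTheorem11 {p : ℕ} [Fact p.Prime] {K : Type*} [Field K] [CharP K p]
    (δ : PetitExt.Der K)
    (hδ : minpoly (PetitExt.constField δ) (PetitExt.constEnd δ) = Polynomial.X ^ p - Polynomial.X) :
    PetitExt.constField (PetitExt.ratDer δ) = PetitExt.ratSubfield (PetitExt.constField δ) ∧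
    minpoly (PetitExt.constField (PetitExt.ratDer δ)) (PetitExt.constEnd (PetitExt.ratDer δ)) =
      Polynomial.X ^ p - Polynomial.X ∧
    ∀ h : RatFunc K, h ∉ PetitExt.ratSubfield (PetitExt.constField δ) →
      Irreducible (PetitExt.cyclicPoly p (PetitExt.ratDer δ) h) ∧
      PetitExt.IsDivisionAlgebra (PetitExt.ratSubfield (PetitExt.constField δ))
        (PetitExt.CyclicExt p (PetitExt.ratDer δ) h) ∧
      (¬ ∀ a b c : PetitExt.CyclicExt p (PetitExt.ratDer δ) h, a * b * c = a * (b * c)) ∧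
      Module.finrank (PetitExt.ratSubfield (PetitExt.constField δ))
        (PetitExt.CyclicExt p (PetitExt.ratDer δ) h) = p ^ 2 ∧
      PetitExt.IsNonassocCyclicExtension p (PetitExt.ratSubfield (PetitExt.constField δ))
        (RatFunc K) (PetitExt.CyclicExt p (PetitExt.ratDer δ) h) := by
  obtain ⟨u, hu0, hu⟩ := PetitExt.exists_eigenvector_of_minpoly δ hδ
  have hp := (Fact.out : p.Prime)
  have hpow : ∀ a, (PetitExt.ratDer δ)^[p] a = PetitExt.ratDer δ a :=
    PetitExt.ratDer_iterate_eq δ ((PetitExt.aeval_constEnd_X_pow_sub_X_eq_zero_iff δ).1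
      (hδ ▸ minpoly.aeval _ _))
  have hv0 : RatFunc.C u ≠ 0 := (_root_.map_ne_zero _).2 hu0
  have hv : PetitExt.ratDer δ (RatFunc.C u) = RatFunc.C u := by rw [PetitExt.ratDer_C, hu]
  have hconst := PetitExt.constField_ratDer p δ
  refine ⟨hconst, PetitExt.minpoly_constEnd_eq _ hpow hv0 hv, ?_⟩
  rw [← hconst]
  intro h hh
  have hrank := PetitExt.finrank_constField _ hpow hv0 hv
  have : Module.Finite (PetitExt.constField (PetitExt.ratDer δ)) (RatFunc K) :=
    Module.finite_of_finrank_pos (hrank ▸ hp.pos)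
  have hirr := PetitExt.DiffPoly.irreducible_cyclicPoly hpow (show PetitExt.ratDer δ h ≠ 0 from hh)
  have hdiv := PetitExt.PetitAlgebra.isDivisionAlgebra hirr
  refine ⟨hirr, hdiv, PetitExt.CyclicExt.not_assoc hpow hh, ?_,
    PetitExt.CyclicExt.isNonassocCyclicExtension hdiv⟩
  -- Tower law: degree `p` of `K(x)` over its constants, times dimension `deg f = p` over `K(x)`.
  rw [← Module.finrank_mul_finrank _ (RatFunc K), hrank, PetitExt.PetitAlgebra.finrank_eq,
    PetitExt.DiffPoly.natDegree_cyclicPoly, sq]
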